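/- **Setting.** Let $\mathcal X,\mathcal A$ be finite sets, $N,T\ge 1$, $p=(p_n)_{1\le n\le N}$ a transition kernel, $p_n(x'\mid x,a)$, and $\rho\in\Delta_{\mathcal X\times\mathcal A}$. A policy is $\pi=(\pi_n)_{1\le n\le N}$ with $\pi_n(\cdot\mid x)\in\Delta_{\mathcal A}$. For nonnegative kernels $q$ and an initial vector $\nu$, let $\mu^{\pi,q,\nu}$ be given by $\mu_0=\nu$, $\mu_{n+1}(x,a)=\sum_{x',a'}\mu_n(x',a')\,q_{n+1}(x\mid x',a')\,\pi_{n+1}(a\mid x)$. Let $P_\pi$ be the product over $n=1,\dots,N$ of the matrices $\big(p_n(x'\mid x,a)\pi_n(a'\mid x')\big)_{(x,a),(x',a')}$, so that $\nu P_\pi=\mu^{\pi,p,\nu}_N$. A policy is *periodic* if $\rho P_\pi=\rho$. Assume that a periodic policy exists and that, for some $\alpha\in[0,1)$, $\|\nu P_\pi-\nu'P_\pi\|_1\le\alpha\|\nu-\nu'\|_1$ for all periodic $\pi$ and all $\nu,\nu'\in\Delta_{\mathcal X\times\mathcal A}$. **Protocol.** For episodes $t=1,\dots,T$, policies $\pi_t$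 are played without reset: $\rho_1=\rho$, $\rho_{t+1}=\rho_tP_{\pi_t}$. In episode $t$ the learner observes one trajectory $(x_{t,n},a_{t,n})_{0\le n\le N}$; given the information $\mathcal F_t$ available before episode $t$ (for which $\pi_t$ is measurable, and which contains the earlier observed trajectories), it has the law of a trajectory started from $\rho_t$ that follows $\pi_t$ and $p$. The losses are $F_t(\mu)=\sum_{n=1}^N f_{t,n}(\mu_n)$, where the functions $f_{t,n}:\mathbb R^{\mathcal X\times\mathcal A}\to\mathbb R$ are arbitrary (possibly depending on the run) convex functions that are $\ell$-Lipschitz for $\|\cdot\|_1$. Let $$N_{t,n}(x,a)=\sum_{s<t}\mathbf 1\{x_{s,n}=x,\,a_{s,n}=a\},\qquad M_{t,n}(x'\mid x,a)=\sum_{s<t}\mathbf 1\{x_{s,n}=x,\,a_{s,n}=a,\,x_{s,n+1}=x'\},$$ $\hat p_{1,n}\equiv 1/|\mathcal X|$ and $\hat p_{t,n+1}(x'\mid x,a)=M_{t,n}(x'\mid x,a)/\max\{1,N_{t,n}(x,a)\}$ for $t\ge2$. Write $\hat\mu_t^{\pi,\nu}=\mu^{\pi,\hat p_t,\nu}$ and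 $\mu_t=\hat\mu_t^{\pi_t,\rho_t}$, and let $\ell_t=(\ell_{t,n})_{1\le n\le N}$ be a (sub)gradient of $F_t$ at $\mu_t$. For $\delta\in(0,1)$ put $C_\delta=\sqrt{2|\mathcal X|\log(|\mathcal X||\mathcal A|NT/\delta)}$ and $$b_{t,n}(x,a)=\frac{C_\delta}{\sqrt{\max\{1,N_{t,n}(x,a)\}}},\qquad \bar b_{t,n}(x,a)=\ell\,(N-n)\,b_{t,n}(x,a).$$ **Algorithm (MDPP-K).** The initial policy $\pi_1$ is arbitrary. For $1\le t<T$ let $K_{t+1}$ be the set of nonnegative sequences $\mu=(\mu_n)_{0\le n\le N}$ with $\mu_0=\rho_{t+1}$, $\sum_a\mu_{n+1}(x,a)=\sum_{x',a'}\mu_n(x',a')\,\hat p_{t+1,n+1}(x\mid x',a')$ for $0\le n<N$, and $$\|\mu_N-\rho\|_1\le\sum_{n=0}^{N-1}\langle\mu_n,b_{t+1,n}\rangle+\alpha\|\rho_{t+1}-\rho\|_1 .$$ If $K_{t+1}\neq\emptyset$, the policy $\pi_{t+1}$ is such that $\mu_{t+1}=\hat\mu_{t+1}^{\pi_{t+1},\rho_{t+1}}$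 minimizes $\eta\langle\ell_t-\bar b_t,\mu\rangle+D_\psi(\mu,\mu_t)$ over $\mu\in K_{t+1}$; otherwise $\pi_{t+1}$ is arbitrary. Here $\eta>0$, $D_\psi$ is the Bregman divergence of a convex function $\psi$ (with any convention for its value at points where $\psi$ has no gradient), and $\langle z,\mu\rangle=\sum_{n=1}^N\langle z_n,\mu_n\rangle$ for sequences. **Proposition.** There are universal constants $C>0$ and $k\in\mathbb N$ such that in every such setting, with probability at least $1-3\delta$, for all periodic policies $\pi$ simultaneously, $$\sum_{t=1}^T\big\langle \ell_t-\bar b_t,\ \hat\mu_t^{\pi,\rho_t}-\hat\mu_t^{\pi,\rho}\big\rangle\ \le\ \frac{C}{1-\alpha}\,\ell\,N^4|\mathcal X|^2\sqrt{|\mathcal A|T}\;\log^k\!\Big(\frac{|\mathcal X||\mathcal A|NT}{\delta}\Big).$$ (That is, the set of outcomes where this fails for some periodic $\pi$ has outer probability at most $3\delta$.) -/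

import Mathlib

open MeasureTheory ProbabilityTheory

universe u v w

/-!
Conventions.  States `X` and actions `A` are finite; vectors indexed by state-action pairs are
functions `X × A → ℝ`.  A transition kernel is `p n x a x'` (probability of moving to `x'` at step
`n` from `x` under `a`), a policy is `π n x a`; only the steps `1 ≤ n ≤ N` are relevant.
A sequence of state-action distributions is `μ n y`; only `0 ≤ n ≤ N` is relevant.
Episodes are numbered from `0`: index `t` is the episode number `t + 1`, so that the episodes
are `t = 0, …, T - 1` and exactly the episodes `s < t` precede episode `t`.
-/
namespace PeriodicMDP

/-- The `L¹` norm of a vector on state-action pairs. -/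
def l1 {X : Type u} {A : Type v} [Fintype X] [Fintype A] (u : X × A → ℝ) : ℝ := ∑ y, |u y|

/-- `p` is a family of probability kernels at the steps `1, …, N`. -/
def IsKernel {X : Type u} {A : Type v} [Fintype X] (N : ℕ) (p : ℕ → X → A → X → ℝ) : Prop :=
  ∀ n ∈ Finset.Icc 1 N, ∀ x a, p n x a ∈ stdSimplex ℝ X

/-- `π` is a (randomized, non-stationary, Markov) policy over the steps `1, …, N`. -/
def IsPolicy {X : Type u} {A : Type v} [Fintype A] (N : ℕ) (π : ℕ → X → A → ℝ) : Prop :=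
  ∀ n ∈ Finset.Icc 1 N, ∀ x, π n x ∈ stdSimplex ℝ A

/-- One-step transition matrix on state-action pairs: `p_n(x' | x, a) π_n(a' | x')`. -/
def stepMatrix {X : Type u} {A : Type v} (p : ℕ → X → A → X → ℝ) (π : ℕ → X → A → ℝ) (n : ℕ) :
    Matrix (X × A) (X × A) ℝ :=
  Matrix.of fun y y' => p n y.1 y.2 y'.1 * π n y'.1 y'.2

/-- The matrix `P_π` of the first `n` steps: the product of the one-step matrices `1, …, n`. -/
def episodeMatrix {X : Type u} {A : Type v} [Fintype X] [Fintype A] [DecidableEq X]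
    [DecidableEq A] (p : ℕ → X → A → X → ℝ) (π : ℕ → X → A → ℝ) :
    ℕ → Matrix (X × A) (X × A) ℝ
  | 0 => 1
  | n + 1 => episodeMatrix p π n * stepMatrix p π (n + 1)

/-- The sequence `μ^{π,ν}` of state-action distributions induced by the policy `π`, the dynamics `p`
and the initial distribution `ν` (the forward equation). -/
def occ {X : Type u} {A : Type v} [Fintype X] [Fintype A]
    (p : ℕ → X → A → X → ℝ) (π : ℕ → X → A → ℝ) (ν : X × A → ℝ) : ℕ → X × A → ℝ
  | 0 => ν
  | n + 1 => fun y =>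
      ∑ y', occ p π ν n y' * p (n + 1) y'.1 y'.2 y.1 * π (n + 1) y.1 y.2

/-- `ν P_π` is the last term of the forward equation. -/
theorem vecMul_episodeMatrix {X : Type u} {A : Type v} [Fintype X] [Fintype A] [DecidableEq X]
    [DecidableEq A] (p : ℕ → X → A → X → ℝ) (π : ℕ → X → A → ℝ) (ν : X × A → ℝ) (n : ℕ) :
    Matrix.vecMul ν (episodeMatrix p π n) = occ p π ν n := by
  induction n with
  | zero => simp [episodeMatrix, occ]
  | succ n ih =>
    rw [episodeMatrix, ← Matrix.vecMul_vecMul, ih]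
    funext y
    simp [occ, Matrix.vecMul, dotProduct, stepMatrix, mul_assoc]

/-- `π` is a periodic policy for the initial distribution `ρ`: `ρ P_π = ρ`. -/
def IsPeriodic {X : Type u} {A : Type v} [Fintype X] [Fintype A] [DecidableEq X]
    [DecidableEq A] (N : ℕ) (p : ℕ → X → A → X → ℝ) (ρ : X × A → ℝ) (π : ℕ → X → A → ℝ) : Prop :=
  IsPolicy N π ∧ Matrix.vecMul ρ (episodeMatrix p π N) = ρ

/-- Contraction with factor `α`, in `L¹` norm, of the episode kernel of every periodic policy. -/
def PeriodicContraction {X : Type u} {A : Type v} [Fintype X] [Fintype A] [DecidableEq X]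
    [DecidableEq A] (N : ℕ) (p : ℕ → X → A → X → ℝ) (ρ : X × A → ℝ) (α : ℝ) : Prop :=
  ∀ π, IsPeriodic N p ρ π → ∀ ν ∈ stdSimplex ℝ (X × A), ∀ ν' ∈ stdSimplex ℝ (X × A),
    l1 (Matrix.vecMul ν (episodeMatrix p π N) - Matrix.vecMul ν' (episodeMatrix p π N))
      ≤ α * l1 (ν - ν')

/-- The initial distributions of the successive episodes when the policies `π 0, π 1, …` are
played without reset: `ρ_1 = ρ` and `ρ_{t+1} = ρ_t P_{π_t}`. -/
def startDist {X : Type u} {A : Type v} [Fintype X] [Fintype A] [DecidableEq X]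
    [DecidableEq A] (N : ℕ) (p : ℕ → X → A → X → ℝ) (ρ : X × A → ℝ)
    (π : ℕ → ℕ → X → A → ℝ) : ℕ → X × A → ℝ
  | 0 => ρ
  | t + 1 => Matrix.vecMul (startDist N p ρ π t) (episodeMatrix p (π t) N)

/-- Probability of the trajectory `y 0, …, y N` under initial law `ν`, dynamics `p`, policy `π`. -/
def trajProb {X : Type u} {A : Type v} (N : ℕ) (p : ℕ → X → A → X → ℝ) (π : ℕ → X → A → ℝ)
    (ν : X × A → ℝ) (y : ℕ → X × A) : ℝ :=
  ν (y 0) * ∏ n ∈ Finset.range N, stepMatrix p π (n + 1) (y n) (y (n + 1))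

/-- Number of visits of the pair `y` at step `n` in the episodes before `t`;
`Y s n` is the state-action pair observed at step `n` of episode `s`. -/
def visits {X : Type u} {A : Type v} [DecidableEq X] [DecidableEq A]
    (Y : ℕ → ℕ → X × A) (t n : ℕ) (y : X × A) : ℕ :=
  ((Finset.range t).filter fun s => Y s n = y).card

/-- Number of transitions from the pair `y` at step `n` to the state `x'` at step `n + 1` in the
episodes before `t`. -/
def transitions {X : Type u} {A : Type v} [DecidableEq X] [DecidableEq A]
    (Y : ℕ → ℕ → X × A) (t n : ℕ) (y : X × A) (x' : X) : ℕ :=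
  ((Finset.range t).filter fun s => Y s n = y ∧ (Y s (n + 1)).1 = x').card

/-- The empirical kernel used in episode `t`: uniform in the first episode, afterwards
`p̂_{t,n}(x' | x, a) = M_{t,n-1}(x' | x, a) / max {1, N_{t,n-1}(x, a)}` for `1 ≤ n ≤ N`. -/
noncomputable def estKernel {X : Type u} {A : Type v} [Fintype X] [DecidableEq X]
    [DecidableEq A] (Y : ℕ → ℕ → X × A) (t : ℕ) : ℕ → X → A → X → ℝ :=
  fun n x a x' =>
    if t = 0 then 1 / (Fintype.card X : ℝ)
    else (transitions Y t (n - 1) (x, a) x' : ℝ) / max 1 (visits Y t (n - 1) (x, a) : ℝ)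

/-- `C_δ = √(2 |X| log (|X| |A| N T / δ))`. -/
noncomputable def bonusConst (X : Type u) (A : Type v) [Fintype X] [Fintype A]
    (N T : ℕ) (δ : ℝ) : ℝ :=
  √(2 * Fintype.card X *
      Real.log ((Fintype.card X : ℝ) * Fintype.card A * N * T / δ))

/-- The bonus `b_{t,n}(x, a) = C_δ / √(max {1, N_{t,n}(x, a)})`. -/
noncomputable def bonus {X : Type u} {A : Type v} [Fintype X] [Fintype A] [DecidableEq X]
    [DecidableEq A] (N T : ℕ) (δ : ℝ) (Y : ℕ → ℕ → X × A) (t n : ℕ) (y : X × A) : ℝ :=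
  bonusConst X A N T δ / √(max 1 (visits Y t n y : ℝ))

/-- The bonus `b̄_{t,n}(x, a) = ℓ (N - n) C_δ / √(max {1, N_{t,n}(x, a)})`. -/
noncomputable def lossBonus {X : Type u} {A : Type v} [Fintype X] [Fintype A] [DecidableEq X]
    [DecidableEq A] (N T : ℕ) (δ ℓ : ℝ) (Y : ℕ → ℕ → X × A) (t n : ℕ) (y : X × A) : ℝ :=
  ℓ * ((N : ℝ) - n) * bonusConst X A N T δ / √(max 1 (visits Y t n y : ℝ))

/-- `⟨z, μ⟩ = ∑_{n=1}^N ⟨z_n, μ_n⟩`, the pairing of sequences of vectors. -/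
def pairing {X : Type u} {A : Type v} [Fintype X] [Fintype A] (N : ℕ)
    (z μ : ℕ → X × A → ℝ) : ℝ :=
  ∑ n ∈ Finset.Icc 1 N, ∑ y, z n y * μ n y

/-- The set `M_ν^p` of nonnegative sequences that start at `ν` and satisfy the dynamics `p`.
The terms have mass one when `p` is a probability kernel; an empirical kernel has zero rows at
unvisited pairs. -/
def flowSet {X : Type u} {A : Type v} [Fintype X] [Fintype A] (N : ℕ)
    (p : ℕ → X → A → X → ℝ) (ν : X × A → ℝ) : Set (ℕ → X × A → ℝ) :=
  {μ | (∀ n ≤ N, ∀ y, 0 ≤ μ n y) ∧ μ 0 = ν ∧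
    ∀ n < N, ∀ x, ∑ a, μ (n + 1) (x, a) = ∑ y, μ n y * p (n + 1) y.1 y.2 x}

/-- The elements `μ` of `M_ν^{q}` with `‖μ_N - ρ‖₁ ≤ ∑_{n=0}^{N-1} ⟨μ_n, b_n⟩ + α ‖ν - ρ‖₁`. -/
def feasibleSet {X : Type u} {A : Type v} [Fintype X] [Fintype A] (N : ℕ)
    (q : ℕ → X → A → X → ℝ) (ν ρ : X × A → ℝ) (b : ℕ → X × A → ℝ) (α : ℝ) :
    Set (ℕ → X × A → ℝ) :=
  {μ | μ ∈ flowSet N q ν ∧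
    l1 (μ N - ρ) ≤ (∑ n ∈ Finset.range N, ∑ y, μ n y * b n y) + α * l1 (ν - ρ)}

/-- The terms `0, …, N` of a sequence, as an element of a finite-dimensional space. -/
def trunc {X : Type u} {A : Type v} (N : ℕ) (μ : ℕ → X × A → ℝ) : Fin (N + 1) → X × A → ℝ :=
  fun n => μ n

/-- `D` is the Bregman divergence `ψ(μ) - ψ(μ') - ⟨∇ψ(μ'), μ - μ'⟩` induced by the convex function
`ψ`; at points `μ'` where `ψ` has no gradient (as the entropy on the boundary of the orthant)
any convention for its value is allowed. -/
def IsBregmanDivergence {X : Type u} {A : Type v} [Fintype X] [Fintype A] (N : ℕ)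
    (ψ : (Fin (N + 1) → X × A → ℝ) → ℝ)
    (D : (Fin (N + 1) → X × A → ℝ) → (Fin (N + 1) → X × A → ℝ) → ℝ) : Prop :=
  ConvexOn ℝ {μ | 0 ≤ μ} ψ ∧
    ∀ μ μ', 0 ≤ μ → 0 ≤ μ' → DifferentiableAt ℝ ψ μ' →
      D μ μ' = ψ μ - ψ μ' - fderiv ℝ ψ μ' (μ - μ')

/-- `f` is `ℓ`-Lipschitz for the `L¹` norm. -/
def LipschitzL1 {X : Type u} {A : Type v} [Fintype X] [Fintype A] (ℓ : ℝ)
    (f : (X × A → ℝ) → ℝ) : Prop :=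
  ∀ u v, |f u - f v| ≤ ℓ * l1 (u - v)

/-- `g` is a subgradient of `f` at `u` (the gradient, if the convex function `f` has one). -/
def IsSubgradient {X : Type u} {A : Type v} [Fintype X] [Fintype A]
    (f : (X × A → ℝ) → ℝ) (g u : X × A → ℝ) : Prop :=
  ∀ v, f u + ∑ y, g y * (v y - u y) ≤ f v

/-- A run, over `T` episodes of length `N`, of mirror descent for periodic policies with known
initial distributions, with parameters `α`, `δ`, `ℓ`, `η` and divergence `D`.  On a
filtered probability space, with `𝓕 t` the information available before episode `t`,
* `Y t ω n` is the state-action pair at step `n` of the trajectory observed in episode `t`,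
* `π t ω` is the policy played in episode `t`,
* `f t ω n` are the losses of episode `t` and `g t ω n` the subgradients that the learner uses. -/
structure IsRun {X : Type u} {A : Type v} [Fintype X] [Fintype A] [DecidableEq X] [DecidableEq A]
    {Ω : Type w} [mΩ : MeasurableSpace Ω] (P : Measure Ω) (𝓕 : Filtration ℕ mΩ)
    (N T : ℕ) (p : ℕ → X → A → X → ℝ) (ρ : X × A → ℝ) (α δ ℓ η : ℝ)
    (D : (Fin (N + 1) → X × A → ℝ) → (Fin (N + 1) → X × A → ℝ) → ℝ)
    (f : ℕ → Ω → ℕ → (X × A → ℝ) → ℝ) (g : ℕ → Ω → ℕ → X × A → ℝ)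
    (Y : ℕ → Ω → ℕ → X × A) (π : ℕ → Ω → ℕ → X → A → ℝ) : Prop where
  /-- The losses are convex and `ℓ`-Lipschitz. -/
  loss_convex : ∀ t < T, ∀ ω, ∀ n ∈ Finset.Icc 1 N,
    ConvexOn ℝ Set.univ (f t ω n) ∧ LipschitzL1 ℓ (f t ω n)
  /-- `ℓ_t = ∇F_t(μ_t)` at `μ_t`, the sequence induced by `π_t` and `ρ_t` in the estimated model. -/
  subgradient : ∀ t < T, ∀ ω, ∀ n ∈ Finset.Icc 1 N,
    IsSubgradient (f t ω n) (g t ω n)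
      (occ (estKernel (fun s => Y s ω) t) (π t ω)
        (startDist N p ρ (fun s => π s ω) t) n)
  /-- Every `π_t` is a policy. -/
  policy : ∀ t < T, ∀ ω, IsPolicy N (π t ω)
  /-- `π_t` is chosen before episode `t`. -/
  policy_adapted : ∀ t < T, ∀ n ∈ Finset.Icc 1 N, ∀ x a,
    Measurable[𝓕 t] fun ω => π t ω n x a
  /-- The trajectory of episode `t` is known after episode `t`. -/
  traj_adapted : ∀ t < T, ∀ n ≤ N, ∀ y, MeasurableSet[𝓕 (t + 1)] {ω | Y t ω n = y}
  /-- Given the past, the trajectory observed in episode `t` is one of an agent that starts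
  from `ρ_t` and plays `π_t` in the true dynamics. -/
  traj_law : ∀ t < T, ∀ y : ℕ → X × A,
    P[({ω | ∀ n ≤ N, Y t ω n = y n}).indicator (fun _ => (1 : ℝ)) | 𝓕 t] =ᵐ[P]
      fun ω => trajProb N p (π t ω) (startDist N p ρ (fun s => π s ω) t) y
  /-- From the second episode on, the policy played induces, in the estimated model, a minimizer of
  `η ⟨ℓ_t - b̄_t, μ⟩ + D(μ, μ_t)` over the feasible set, provided this set is nonempty. -/
  mirror_step : ∀ t, t + 1 < T → ∀ ω,
    let q : ℕ → ℕ → X → A → X → ℝ := fun s => estKernel (fun r => Y r ω) s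
    let ρs : ℕ → X × A → ℝ := startDist N p ρ (fun s => π s ω)
    let μs : ℕ → ℕ → X × A → ℝ := fun s => occ (q s) (π s ω) (ρs s)
    let K : Set (ℕ → X × A → ℝ) :=
      feasibleSet N (q (t + 1)) (ρs (t + 1)) ρ (bonus N T δ (fun r => Y r ω) (t + 1)) α
    let obj : (ℕ → X × A → ℝ) → ℝ := fun μ =>
      η * pairing N (g t ω - lossBonus N T δ ℓ (fun r => Y r ω) t) μ
        + D (trunc N μ) (trunc N (μs t))
    K.Nonempty → μs (t + 1) ∈ K ∧ ∀ μ ∈ K, obj (μs (t + 1)) ≤ obj μ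

/-- `∑_t ⟨ℓ_t - b̄_t, μ̂_t^{π, ρ_t} - μ̂_t^{π, ρ}⟩`, for the observed trajectories `Y`, the
played policies `π`, the subgradients `g` and a comparator policy `πc`. -/
noncomputable def diffRegret {X : Type u} {A : Type v} [Fintype X] [Fintype A] [DecidableEq X]
    [DecidableEq A] (N T : ℕ) (p : ℕ → X → A → X → ℝ) (ρ : X × A → ℝ) (δ ℓ : ℝ)
    (g : ℕ → ℕ → X × A → ℝ) (Y : ℕ → ℕ → X × A) (π : ℕ → ℕ → X → A → ℝ)
    (πc : ℕ → X → A → ℝ) : ℝ :=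
  ∑ t ∈ Finset.range T,
    pairing N (g t - lossBonus N T δ ℓ Y t)
      (occ (estKernel Y t) πc (startDist N p ρ π t) - occ (estKernel Y t) πc ρ)

end PeriodicMDP

/-! The two occupancy sequences in each summand differ only in their starting law. The forward
equation under a substochastic kernel is nonexpansive in L¹, subgradients are bounded by ℓ and loss
bonuses by ℓ N C (with C the bonus constant), so the whole sum is at most N ℓ (1 + N C) ∑ₜ ‖ρₜ - ρ‖₁
(`diffRegret_le_sum_l1`). It remains to see that the starting laws do not drift away from ρ.

Suppose that the true kernel is within the bonus of the empirical one (`ModelAccurate`). Then a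
periodic policy, run in the estimated model, satisfies the constraint (`occ_mem_feasibleSet`): its
true final law is α-close to ρ by contraction, and the model error is paid by the bonuses. Hence the
feasible sets are nonempty and the mirror step yields a feasible iterate. Feasibility of the iterate
and the model error of the played policy together give ‖ρₜ₊₁ - ρ‖₁ ≤ 2 βₜ + α ‖ρₜ - ρ‖₁, where βₜ is
the bonus expected in the estimated model, itself at most 1 + N C times the bonus expected in the
true one. Summing over t produces the factor 1 / (1 - α) (`sum_l1_startDist_le`). Expected bonuses
are compared with collected ones by Azuma's inequality (`measure_sum_bonus_le`), and the collected
ones add up to O(C √(|X||A|T)) per step because each visit increases a count.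

Both concentration bounds come from one device, `IsFactor`: a product over episodes of nonnegative
factors with conditional mean at most one, followed by Markov's inequality. For the model, the L¹
error is a maximum over sign vectors, and the factors are frozen after m visits; a union over steps,
pairs, signs and m costs 2δ. Azuma costs δ. The bad event does not involve the comparator, so the
bound holds for all periodic policies at once. -/

namespace PeriodicMDP

/-- A family of nonnegative kernels of mass at most one. -/
def IsSubkernel {X : Type u} {A : Type v} [Fintype X] (N : ℕ) (q : ℕ → X → A → X → ℝ) : Prop :=
  ∀ n ∈ Finset.Icc 1 N, ∀ x a, (∀ x', 0 ≤ q n x a x') ∧ ∑ x', q n x a x' ≤ 1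

theorem IsKernel.isSubkernel {X : Type u} {A : Type v} [Fintype X] {N : ℕ}
    {p : ℕ → X → A → X → ℝ} (hp : IsKernel N p) : IsSubkernel N p :=
  fun n hn x a => ⟨(hp n hn x a).1, (hp n hn x a).2.le⟩

/-! ### The forward equation under substochastic kernels. -/

section Deterministic

variable {X : Type u} {A : Type v} [Fintype X] [Fintype A]

theorem l1_nonneg (u : X × A → ℝ) : 0 ≤ l1 u := Finset.sum_nonneg fun _ _ => abs_nonneg _

theorem l1_add_le (u v : X × A → ℝ) : l1 (u + v) ≤ l1 u + l1 v := by
  unfold l1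
  rw [← Finset.sum_add_distrib]
  exact Finset.sum_le_sum fun y _ => abs_add_le _ _

theorem l1_sub_comm (u v : X × A → ℝ) : l1 (u - v) = l1 (v - u) := by
  unfold l1
  exact Finset.sum_congr rfl fun y _ => abs_sub_comm _ _

theorem l1_sub_le (u v w : X × A → ℝ) : l1 (u - w) ≤ l1 (u - v) + l1 (v - w) := by
  have h := l1_add_le (u - v) (v - w)
  rwa [sub_add_sub_cancel] at h

theorem l1_eq_one {u : X × A → ℝ} (hu : u ∈ stdSimplex ℝ (X × A)) : l1 u = 1 := by
  rw [← hu.2]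
  exact Finset.sum_congr rfl fun y _ => abs_of_nonneg (hu.1 y)

theorem l1_sub_le_two {u v : X × A → ℝ} (hu : u ∈ stdSimplex ℝ (X × A))
    (hv : v ∈ stdSimplex ℝ (X × A)) : l1 (u - v) ≤ 2 := by
  have h := l1_sub_le u 0 v
  rw [sub_zero, l1_sub_comm 0 v, sub_zero, l1_eq_one hu, l1_eq_one hv] at h
  linarith

/-- One step of the forward equation. -/
def push (q : ℕ → X → A → X → ℝ) (π : ℕ → X → A → ℝ) (n : ℕ) (w : X × A → ℝ) : X × A → ℝ :=
  fun y => ∑ y', w y' * q n y'.1 y'.2 y.1 * π n y.1 y.2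

theorem occ_succ (q : ℕ → X → A → X → ℝ) (π : ℕ → X → A → ℝ) (ν : X × A → ℝ) (n : ℕ) :
    occ q π ν (n + 1) = push q π (n + 1) (occ q π ν n) := rfl

theorem push_sub (q : ℕ → X → A → X → ℝ) (π : ℕ → X → A → ℝ) (n : ℕ) (w w' : X × A → ℝ) :
    push q π n (w - w') = push q π n w - push q π n w' := by
  funext y
  simp [push, sub_mul, Finset.sum_sub_distrib]

theorem sum_push_action (q : ℕ → X → A → X → ℝ) {π : ℕ → X → A → ℝ} {N n : ℕ}
    (hπ : IsPolicy N π) (hn : n ∈ Finset.Icc 1 N) (w : X × A → ℝ) (x : X) :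
    ∑ a, push q π n w (x, a) = ∑ y, w y * q n y.1 y.2 x := by
  unfold push
  rw [Finset.sum_comm]
  refine Finset.sum_congr rfl fun y _ => ?_
  simp only
  rw [← Finset.mul_sum, (hπ n hn x).2, mul_one]

theorem sum_push (q : ℕ → X → A → X → ℝ) {π : ℕ → X → A → ℝ} {N n : ℕ}
    (hπ : IsPolicy N π) (hn : n ∈ Finset.Icc 1 N) (w : X × A → ℝ) :
    ∑ y, push q π n w y = ∑ y, w y * ∑ x, q n y.1 y.2 x := by
  rw [Fintype.sum_prod_type]
  simp_rw [sum_push_action q hπ hn w, Finset.mul_sum]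
  rw [Finset.sum_comm]

theorem l1_push_le (q : ℕ → X → A → X → ℝ) {π : ℕ → X → A → ℝ} {N n : ℕ}
    (hπ : IsPolicy N π) (hn : n ∈ Finset.Icc 1 N) (w : X × A → ℝ) :
    l1 (push q π n w) ≤ ∑ y, |w y| * ∑ x, |q n y.1 y.2 x| := by
  have h := sum_push (fun n x a x' => |q n x a x'|) hπ hn (fun y => |w y|)
  refine le_trans (Finset.sum_le_sum fun y _ => ?_) h.le
  refine (Finset.abs_sum_le_sum_abs _ _).trans (Finset.sum_le_sum fun y' _ => ?_)
  rw [abs_mul, abs_mul, abs_of_nonneg ((hπ n hn y.1).1 y.2)]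

theorem l1_push_le_l1 {q : ℕ → X → A → X → ℝ} {π : ℕ → X → A → ℝ} {N n : ℕ}
    (hq : IsSubkernel N q) (hπ : IsPolicy N π) (hn : n ∈ Finset.Icc 1 N) (w : X × A → ℝ) :
    l1 (push q π n w) ≤ l1 w := by
  refine (l1_push_le q hπ hn w).trans (Finset.sum_le_sum fun y _ => ?_)
  refine mul_le_of_le_one_right (abs_nonneg _) ?_
  rw [Finset.sum_congr rfl fun x _ => abs_of_nonneg ((hq n hn y.1 y.2).1 x)]
  exact (hq n hn y.1 y.2).2

theorem occ_nonneg {q : ℕ → X → A → X → ℝ} {π : ℕ → X → A → ℝ} {N : ℕ} {ν : X × A → ℝ}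
    (hq : IsSubkernel N q) (hπ : IsPolicy N π) (hν : ∀ y, 0 ≤ ν y) :
    ∀ n ≤ N, ∀ y, 0 ≤ occ q π ν n y
  | 0, _, y => hν y
  | n + 1, hn, y => Finset.sum_nonneg fun y' _ => by
      have hm : n + 1 ∈ Finset.Icc 1 N := Finset.mem_Icc.2 ⟨by omega, hn⟩
      exact mul_nonneg (mul_nonneg (occ_nonneg hq hπ hν n (by omega) y')
        ((hq _ hm _ _).1 _)) ((hπ _ hm _).1 _)

theorem occ_mem_stdSimplex {p : ℕ → X → A → X → ℝ} {π : ℕ → X → A → ℝ} {N : ℕ}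
    {ν : X × A → ℝ} (hp : IsKernel N p) (hπ : IsPolicy N π) (hν : ν ∈ stdSimplex ℝ (X × A)) :
    ∀ n ≤ N, occ p π ν n ∈ stdSimplex ℝ (X × A)
  | 0, _ => hν
  | n + 1, hn => by
      have hm : n + 1 ∈ Finset.Icc 1 N := Finset.mem_Icc.2 ⟨by omega, hn⟩
      refine ⟨occ_nonneg hp.isSubkernel hπ hν.1 _ hn, ?_⟩
      rw [occ_succ, sum_push p hπ hm]
      simp_rw [(hp _ hm _ _).2, mul_one]
      exact (occ_mem_stdSimplex hp hπ hν n (by omega)).2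

theorem l1_occ_sub_occ_le {q : ℕ → X → A → X → ℝ} {π : ℕ → X → A → ℝ} {N : ℕ}
    (hq : IsSubkernel N q) (hπ : IsPolicy N π) (ν ν' : X × A → ℝ) :
    ∀ n ≤ N, l1 (occ q π ν n - occ q π ν' n) ≤ l1 (ν - ν')
  | 0, _ => le_rfl
  | n + 1, hn => by
      have hm : n + 1 ∈ Finset.Icc 1 N := Finset.mem_Icc.2 ⟨by omega, hn⟩
      rw [occ_succ, occ_succ, ← push_sub]
      exact (l1_push_le_l1 hq hπ hm _).trans (l1_occ_sub_occ_le hq hπ ν ν' n (by omega))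

/-- Sensitivity of the forward equation to the dynamics. -/
theorem l1_occ_kernel_sub_le {q q' : ℕ → X → A → X → ℝ} {π : ℕ → X → A → ℝ} {N : ℕ}
    {ν : X × A → ℝ} (hq : IsSubkernel N q) (hq' : IsSubkernel N q') (hπ : IsPolicy N π)
    (hν : ∀ y, 0 ≤ ν y) : ∀ n ≤ N, l1 (occ q π ν n - occ q' π ν n) ≤
      ∑ m ∈ Finset.range n, ∑ y, occ q' π ν m y *
        ∑ x, |q (m + 1) y.1 y.2 x - q' (m + 1) y.1 y.2 x|
  | 0, _ => by simp [occ, l1]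
  | n + 1, hn => by
      have hm : n + 1 ∈ Finset.Icc 1 N := Finset.mem_Icc.2 ⟨by omega, hn⟩
      -- Telescoping: the old error is transported by `q`, which is nonexpansive, and the fresh
      -- error is weighted by the occupancy under `q'`. Which kernel supplies the weights matters
      -- later, where both orders are used.
      have hsplit : occ q π ν (n + 1) - occ q' π ν (n + 1) =
          push q π (n + 1) (occ q π ν n - occ q' π ν n) +
            push (q - q') π (n + 1) (occ q' π ν n) := by
        funext y
        simp only [occ_succ, push, Pi.sub_apply, Pi.add_apply]
        rw [← Finset.sum_sub_distrib, ← Finset.sum_add_distrib]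
        exact Finset.sum_congr rfl fun y' _ => by ring
      rw [hsplit, Finset.sum_range_succ]
      refine (l1_add_le _ _).trans (add_le_add ?_ ?_)
      · exact (l1_push_le_l1 hq hπ hm _).trans
          (l1_occ_kernel_sub_le hq hq' hπ hν n (by omega))
      · refine (l1_push_le _ hπ hm _).trans_eq (Finset.sum_congr rfl fun y _ => ?_)
        rw [abs_of_nonneg (occ_nonneg hq' hπ hν n (by omega) y)]
        rfl

theorem l1_occ_kernel_sub_le_of_le {q q' : ℕ → X → A → X → ℝ} {π : ℕ → X → A → ℝ} {N : ℕ}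
    {ν : X × A → ℝ} {b : ℕ → X × A → ℝ} (hq : IsSubkernel N q) (hq' : IsSubkernel N q')
    (hπ : IsPolicy N π) (hν : ∀ y, 0 ≤ ν y)
    (hb : ∀ n < N, ∀ y : X × A,
      ∑ x, |q (n + 1) y.1 y.2 x - q' (n + 1) y.1 y.2 x| ≤ b n y) {n : ℕ} (hn : n ≤ N) :
    l1 (occ q π ν n - occ q' π ν n) ≤
      ∑ m ∈ Finset.range n, ∑ y, occ q' π ν m y * b m y := by
  refine (l1_occ_kernel_sub_le hq hq' hπ hν n hn).trans ?_
  refine Finset.sum_le_sum fun m hm => Finset.sum_le_sum fun y _ => ?_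
  have hm' := Finset.mem_range.1 hm
  exact mul_le_mul_of_nonneg_left (hb m (by omega) y) (occ_nonneg hq' hπ hν m (by omega) y)

theorem occ_mem_flowSet {q : ℕ → X → A → X → ℝ} {π : ℕ → X → A → ℝ} {N : ℕ}
    {ν : X × A → ℝ} (hq : IsSubkernel N q) (hπ : IsPolicy N π) (hν : ∀ y, 0 ≤ ν y) :
    occ q π ν ∈ flowSet N q ν :=
  ⟨occ_nonneg hq hπ hν, rfl, fun n hn x => by
    rw [occ_succ]
    exact sum_push_action q hπ (Finset.mem_Icc.2 ⟨by omega, hn⟩) _ x⟩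

/-- The dual of the L¹ norm is the sup norm: test the subgradient inequality at `u` plus or minus a
coordinate vector. -/
theorem abs_le_of_isSubgradient [DecidableEq X] [DecidableEq A] {ℓ : ℝ} {f : (X × A → ℝ) → ℝ}
    {g u : X × A → ℝ} (hf : LipschitzL1 ℓ f) (hg : IsSubgradient f g u) (y : X × A) :
    |g y| ≤ ℓ := by
  have key : ∀ c : ℝ, |c| = 1 → g y * c ≤ ℓ := fun c hc => by
    have h1 := hg (u + Pi.single y c)
    have h2 := (le_abs_self _).trans (hf (u + Pi.single y c) u)
    have h3 : l1 (u + Pi.single y c - u) = 1 := by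
      rw [add_sub_cancel_left]
      unfold l1
      rw [Finset.sum_eq_single y (fun z _ hz => by simp [hz]) (by simp)]
      simpa using hc
    have h4 : ∑ z, g z * ((u + Pi.single y c : X × A → ℝ) z - u z) = g y * c := by
      rw [Finset.sum_eq_single y (fun z _ hz => by simp [hz]) (by simp)]
      simp
    rw [h3] at h2
    rw [h4] at h1
    linarith
  have h1 := key 1 (by simp)
  have h2 := key (-1) (by simp)
  exact abs_le.2 ⟨by linarith, by linarith⟩

theorem pairing_sub_le {N : ℕ} {z μ μ' : ℕ → X × A → ℝ} {B r : ℝ} (hB : 0 ≤ B)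
    (hz : ∀ n ∈ Finset.Icc 1 N, ∀ y, |z n y| ≤ B)
    (hμ : ∀ n ∈ Finset.Icc 1 N, l1 (μ n - μ' n) ≤ r) :
    pairing N z (μ - μ') ≤ N * (B * r) := by
  have h : ∀ n ∈ Finset.Icc 1 N, ∑ y, z n y * (μ - μ') n y ≤ B * r := fun n hn => by
    refine le_trans ?_ (mul_le_mul_of_nonneg_left (hμ n hn) hB)
    unfold l1
    rw [Finset.mul_sum]
    refine Finset.sum_le_sum fun y _ => (le_abs_self _).trans ?_
    rw [abs_mul]
    exact mul_le_mul_of_nonneg_right (hz n hn y) (abs_nonneg _)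
  refine (Finset.sum_le_card_nsmul _ _ _ h).trans_eq ?_
  simp

end Deterministic

/-! ### Visit counts and the empirical kernel. -/

theorem bonusConst_nonneg {X : Type u} {A : Type v} [Fintype X] [Fintype A] (N T : ℕ) (δ : ℝ) :
    0 ≤ bonusConst X A N T δ := Real.sqrt_nonneg _

theorem sum_transitions {X : Type u} {A : Type v} [Fintype X] [DecidableEq X]
    [DecidableEq A] (Y : ℕ → ℕ → X × A) (t n : ℕ) (y : X × A) :
    ∑ x', transitions Y t n y x' = visits Y t n y := by
  unfold transitions visits
  rw [Finset.card_eq_sum_card_fiberwise (f := fun s => (Y s (n + 1)).1) (t := Finset.univ)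
    fun _ _ => Finset.mem_coe.2 (Finset.mem_univ _)]
  simp_rw [Finset.filter_filter]

theorem visits_succ {X : Type u} {A : Type v} [DecidableEq X] [DecidableEq A]
    (Y : ℕ → ℕ → X × A) (t n : ℕ) (y : X × A) :
    visits Y (t + 1) n y = visits Y t n y + if Y t n = y then 1 else 0 := by
  unfold visits
  rw [Finset.range_add_one, Finset.filter_insert]
  split_ifs with h
  · rw [Finset.card_insert_of_notMem (by simp)]
  · rfl

/-- The mass can fall below one: after the first episode the row of an unvisited pair is zero. -/
theorem estKernel_isSubkernel {X : Type u} {A : Type v} [Fintype X] [DecidableEq X]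
    [DecidableEq A] [Nonempty X] (N : ℕ) (Y : ℕ → ℕ → X × A) (t : ℕ) :
    IsSubkernel N (estKernel Y t) := by
  intro n _ x a
  unfold estKernel
  by_cases ht : t = 0
  · simp [ht]
  · simp only [ht, if_false]
    refine ⟨fun x' => by positivity, ?_⟩
    rw [← Finset.sum_div, ← Nat.cast_sum, sum_transitions]
    exact div_le_one_of_le₀ (le_max_right _ _) (by positivity)

/-! ### Pathwise control of the drift of the starting laws. -/

section Pathwise

variable {X : Type u} {A : Type v} [Fintype X] [Fintype A] [DecidableEq X] [DecidableEq A]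

theorem bonus_nonneg (N T : ℕ) (δ : ℝ) (Y : ℕ → ℕ → X × A) (t n : ℕ) (y : X × A) :
    0 ≤ bonus N T δ Y t n y := div_nonneg (bonusConst_nonneg _ _ _) (Real.sqrt_nonneg _)

theorem bonus_le (N T : ℕ) (δ : ℝ) (Y : ℕ → ℕ → X × A) (t n : ℕ) (y : X × A) :
    bonus N T δ Y t n y ≤ bonusConst X A N T δ :=
  div_le_self (bonusConst_nonneg _ _ _) (Real.one_le_sqrt.2 (le_max_left _ _))

theorem lossBonus_eq (N T : ℕ) (δ ℓ : ℝ) (Y : ℕ → ℕ → X × A) (t n : ℕ) (y : X × A) :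
    lossBonus N T δ ℓ Y t n y = ℓ * ((N : ℝ) - n) * bonus N T δ Y t n y :=
  mul_div_assoc _ _ _

theorem sum_visits (Y : ℕ → ℕ → X × A) (t n : ℕ) : ∑ y, visits Y t n y = t := by
  induction t with
  | zero => simp [visits]
  | succ t ih => simp [visits_succ, Finset.sum_add_distrib, ih]

theorem startDist_succ_eq (N : ℕ) (p : ℕ → X → A → X → ℝ) (ρ : X × A → ℝ)
    (π : ℕ → ℕ → X → A → ℝ) (t : ℕ) :
    startDist N p ρ π (t + 1) = occ p (π t) (startDist N p ρ π t) N :=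
  vecMul_episodeMatrix _ _ _ _

theorem startDist_mem_stdSimplex {N T : ℕ} {p : ℕ → X → A → X → ℝ} {ρ : X × A → ℝ}
    {π : ℕ → ℕ → X → A → ℝ} (hp : IsKernel N p) (hρ : ρ ∈ stdSimplex ℝ (X × A))
    (hπ : ∀ t < T, IsPolicy N (π t)) : ∀ t ≤ T, startDist N p ρ π t ∈ stdSimplex ℝ (X × A)
  | 0, _ => hρ
  | t + 1, ht => by
      rw [startDist_succ_eq]
      exact occ_mem_stdSimplex hp (hπ t ht)
        (startDist_mem_stdSimplex hp hρ hπ t (by omega)) N le_rfl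

/-- The increment √(m+1) - √m equals 1 / (√(m+1) + √m), and √(m+1) ≤ 2√m for m ≥ 1, whence the
constant 3. -/
theorem one_div_sqrt_add_le (m : ℕ) :
    1 / √(max 1 (m : ℝ)) + 3 * √(m : ℝ) ≤ 3 * √((m : ℝ) + 1) := by
  rcases Nat.eq_zero_or_pos m with rfl | hm
  · norm_num
  · have hm' : (1 : ℝ) ≤ m := by exact_mod_cast hm
    rw [max_eq_right hm']
    have h0 : 0 < √(m : ℝ) := Real.sqrt_pos.2 (by linarith)
    have h1 := Real.sq_sqrt (show (0 : ℝ) ≤ m by linarith)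
    have h2 := Real.sq_sqrt (show (0 : ℝ) ≤ (m : ℝ) + 1 by linarith)
    have h3 : √((m : ℝ) + 1) ≤ 2 * √(m : ℝ) := by
      rw [Real.sqrt_le_left (by positivity), mul_pow, h1]
      linarith
    have h4 : √(m : ℝ) ≤ √((m : ℝ) + 1) := Real.sqrt_le_sqrt (by linarith)
    rw [div_add' _ _ _ h0.ne', div_le_iff₀ h0]
    nlinarith

/-- Potential argument: an episode raises the count of exactly one pair at step `n`, and the
increase of 3√(count) pays for its term. -/
theorem sum_one_div_sqrt_visits_le (Y : ℕ → ℕ → X × A) (T n : ℕ) :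
    ∑ t ∈ Finset.range T, 1 / √(max 1 (visits Y t n (Y t n) : ℝ)) ≤
      ∑ y, 3 * √(visits Y T n y : ℝ) := by
  induction T with
  | zero => exact Finset.sum_nonneg fun y _ => by positivity
  | succ T ih =>
    rw [Finset.sum_range_succ]
    refine (add_le_add_left ih _).trans ?_
    have h : 1 / √(max 1 (visits Y T n (Y T n) : ℝ)) =
        ∑ y, if Y T n = y then 1 / √(max 1 (visits Y T n y : ℝ)) else 0 := by simp
    rw [h, ← Finset.sum_add_distrib]
    refine Finset.sum_le_sum fun y _ => ?_
    rw [visits_succ]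
    split_ifs
    · have := one_div_sqrt_add_le (visits Y T n y)
      push_cast
      linarith
    · simp

theorem sum_one_div_sqrt_visits_le_sqrt (Y : ℕ → ℕ → X × A) (T n : ℕ) :
    ∑ t ∈ Finset.range T, 1 / √(max 1 (visits Y t n (Y t n) : ℝ)) ≤
      3 * √((Fintype.card X : ℝ) * Fintype.card A * T) := by
  refine (sum_one_div_sqrt_visits_le Y T n).trans ?_
  rw [← Finset.mul_sum]
  refine mul_le_mul_of_nonneg_left (Real.le_sqrt_of_sq_le ?_) (by norm_num)
  -- Cauchy–Schwarz over the pairs; the counts add up to `T`.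
  refine sq_sum_le_card_mul_sum_sq.trans_eq ?_
  simp_rw [Real.sq_sqrt (Nat.cast_nonneg _)]
  rw [← Nat.cast_sum, sum_visits]
  simp

/-- Expected bonuses collected, in the true dynamics, over the steps of one episode. -/
noncomputable def expBonus (N T : ℕ) (p : ℕ → X → A → X → ℝ) (ρ : X × A → ℝ) (δ : ℝ)
    (Y : ℕ → ℕ → X × A) (π : ℕ → ℕ → X → A → ℝ) (t : ℕ) : ℝ :=
  ∑ n ∈ Finset.range N, ∑ y, occ p (π t) (startDist N p ρ π t) n y * bonus N T δ Y t n y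

/-- The true transition probabilities are within the bonus of the estimates, in `L¹` norm. -/
def ModelAccurate (N T : ℕ) (p : ℕ → X → A → X → ℝ) (δ : ℝ) (Y : ℕ → ℕ → X × A) : Prop :=
  ∀ t < T, t ≠ 0 → ∀ n < N, ∀ y : X × A,
    ∑ x, |p (n + 1) y.1 y.2 x - estKernel Y t (n + 1) y.1 y.2 x| ≤ bonus N T δ Y t n y

variable {N T : ℕ} {p : ℕ → X → A → X → ℝ} {ρ : X × A → ℝ} {α δ ℓ : ℝ}
  {Y : ℕ → ℕ → X × A} {π : ℕ → ℕ → X → A → ℝ}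

theorem expBonus_zero (hp : IsKernel N p) (hρ : ρ ∈ stdSimplex ℝ (X × A))
    (hπ : IsPolicy N (π 0)) : expBonus N T p ρ δ Y π 0 = N * bonusConst X A N T δ := by
  have h : ∀ n ∈ Finset.range N, ∑ y, occ p (π 0) (startDist N p ρ π 0) n y *
      bonus N T δ Y 0 n y = bonusConst X A N T δ := fun n hn => by
    simp only [bonus, visits, Finset.range_zero, Finset.filter_empty, Finset.card_empty,
      Nat.cast_zero, startDist]
    rw [← Finset.sum_mul, (occ_mem_stdSimplex hp hπ hρ n (Finset.mem_range.1 hn).le).2]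
    simp
  unfold expBonus
  rw [Finset.sum_congr rfl h]
  simp

/-- The bonuses expected in the estimated model are controlled by those in the true one. -/
theorem sum_occ_estKernel_mul_bonus_le [Nonempty X] (hp : IsKernel N p)
    (hρ : ρ ∈ stdSimplex ℝ (X × A)) (hπ : ∀ t < T, IsPolicy N (π t))
    (hM : ModelAccurate N T p δ Y) {t : ℕ} (ht : t < T) (ht0 : t ≠ 0) :
    ∑ n ∈ Finset.range N, ∑ y,
        occ (estKernel Y t) (π t) (startDist N p ρ π t) n y * bonus N T δ Y t n y ≤
      (1 + N * bonusConst X A N T δ) * expBonus N T p ρ δ Y π t := by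
  have hν := startDist_mem_stdSimplex hp hρ hπ t ht.le
  set ν := startDist N p ρ π t with hνdef
  have hC := bonusConst_nonneg (X := X) (A := A) N T δ
  -- Changing the model in the weights costs at most C times their L¹ distance, and that distance is
  -- again bounded by the bonuses expected in the true model. Over the `N` steps this gives the
  -- factor 1 + N C.
  have hstep : ∀ n ∈ Finset.range N,
      ∑ y, occ (estKernel Y t) (π t) ν n y * bonus N T δ Y t n y ≤
        ∑ y, occ p (π t) ν n y * bonus N T δ Y t n y +
          bonusConst X A N T δ * expBonus N T p ρ δ Y π t := fun n hn => by
    have hn' := Finset.mem_range.1 hn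
    have hdiff : l1 (occ (estKernel Y t) (π t) ν n - occ p (π t) ν n) ≤
        expBonus N T p ρ δ Y π t := by
      refine (l1_occ_kernel_sub_le_of_le (b := bonus N T δ Y t) (estKernel_isSubkernel N Y t)
        hp.isSubkernel (hπ t ht) hν.1 (fun m hm y => ?_) hn'.le).trans ?_
      · refine le_trans (Finset.sum_le_sum fun x _ => ?_) (hM t ht ht0 m hm y)
        rw [abs_sub_comm]
      · refine Finset.sum_le_sum_of_subset_of_nonneg (Finset.range_mono hn'.le) ?_
        intro m hm _
        exact Finset.sum_nonneg fun y _ => mul_nonneg (occ_nonneg hp.isSubkernel (hπ t ht) hν.1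
          m (Finset.mem_range.1 hm).le y) (bonus_nonneg _ _ _ _ _ _ _)
    have hsum : ∑ y, occ (estKernel Y t) (π t) ν n y * bonus N T δ Y t n y -
        ∑ y, occ p (π t) ν n y * bonus N T δ Y t n y ≤
        bonusConst X A N T δ * l1 (occ (estKernel Y t) (π t) ν n - occ p (π t) ν n) := by
      unfold l1
      rw [← Finset.sum_sub_distrib, Finset.mul_sum]
      refine Finset.sum_le_sum fun y _ => ?_
      rw [← sub_mul, mul_comm]
      exact (mul_le_mul_of_nonneg_left (le_abs_self _) (bonus_nonneg _ _ _ _ _ _ _)).trans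
        (mul_le_mul_of_nonneg_right (bonus_le _ _ _ _ _ _ _) (abs_nonneg _))
    have := mul_le_mul_of_nonneg_left hdiff hC
    linarith
  refine (Finset.sum_le_sum hstep).trans_eq ?_
  rw [Finset.sum_add_distrib, Finset.sum_const, Finset.card_range, nsmul_eq_mul, add_mul, one_mul,
    mul_assoc]
  rfl

/-- In an accurate model, periodic policies are feasible. -/
theorem occ_mem_feasibleSet [Nonempty X] (hp : IsKernel N p)
    (hρ : ρ ∈ stdSimplex ℝ (X × A)) (hπ : ∀ t < T, IsPolicy N (π t))
    (hcontr : PeriodicContraction N p ρ α) {πc : ℕ → X → A → ℝ} (hper : IsPeriodic N p ρ πc)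
    (hM : ModelAccurate N T p δ Y) {t : ℕ} (ht : t < T) (ht0 : t ≠ 0) :
    occ (estKernel Y t) πc (startDist N p ρ π t) ∈
      feasibleSet N (estKernel Y t) (startDist N p ρ π t) ρ (bonus N T δ Y t) α := by
  have hν := startDist_mem_stdSimplex hp hρ hπ t ht.le
  set ν := startDist N p ρ π t
  have hq := estKernel_isSubkernel N Y t
  refine ⟨occ_mem_flowSet hq hper.1 hν.1, ?_⟩
  -- Compare through the final law in the true model. The model error is weighted by the occupancy
  -- in the estimated model, exactly as in the slack of the constraint; the rest is the contraction,
  -- since `ρ` is fixed by the episode kernel.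
  refine (l1_sub_le _ (occ p πc ν N) _).trans (add_le_add ?_ ?_)
  · rw [l1_sub_comm]
    exact l1_occ_kernel_sub_le_of_le hp.isSubkernel hq hper.1 hν.1 (hM t ht ht0) le_rfl
  · have h := hcontr πc hper ν hν ρ hρ
    rwa [hper.2, vecMul_episodeMatrix] at h

/-- The bonuses enter twice, once as model error of the played policy and once as slack in the
constraint; hence the factor 2. -/
theorem l1_startDist_succ_le [Nonempty X] (hp : IsKernel N p)
    (hρ : ρ ∈ stdSimplex ℝ (X × A)) (hπ : ∀ t < T, IsPolicy N (π t))
    (hM : ModelAccurate N T p δ Y) {t : ℕ} (ht : t < T) (ht0 : t ≠ 0)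
    (hfeas : occ (estKernel Y t) (π t) (startDist N p ρ π t) ∈
      feasibleSet N (estKernel Y t) (startDist N p ρ π t) ρ (bonus N T δ Y t) α) :
    l1 (startDist N p ρ π (t + 1) - ρ) ≤
      2 * ((1 + N * bonusConst X A N T δ) * expBonus N T p ρ δ Y π t) +
        α * l1 (startDist N p ρ π t - ρ) := by
  have hν := startDist_mem_stdSimplex hp hρ hπ t ht.le
  have h1 := l1_sub_le (startDist N p ρ π (t + 1))
    (occ (estKernel Y t) (π t) (startDist N p ρ π t) N) ρ
  have h2 : l1 (startDist N p ρ π (t + 1) -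
      occ (estKernel Y t) (π t) (startDist N p ρ π t) N) ≤
      ∑ n ∈ Finset.range N, ∑ y, occ (estKernel Y t) (π t) (startDist N p ρ π t) n y *
        bonus N T δ Y t n y := by
    rw [startDist_succ_eq]
    exact l1_occ_kernel_sub_le_of_le hp.isSubkernel (estKernel_isSubkernel N Y t) (hπ t ht) hν.1
      (hM t ht ht0) le_rfl
  have h3 := hfeas.2
  have h4 := sum_occ_estKernel_mul_bonus_le hp hρ hπ hM ht ht0
  linarith

/-- Over all episodes, the initial distributions stay close to `ρ`. -/
theorem sum_l1_startDist_le [Nonempty X] (hN : 1 ≤ N) (hp : IsKernel N p)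
    (hρ : ρ ∈ stdSimplex ℝ (X × A)) (hπ : ∀ t < T, IsPolicy N (π t)) (hα0 : 0 ≤ α) (hα1 : α < 1)
    (hC : 1 ≤ bonusConst X A N T δ) (hM : ModelAccurate N T p δ Y)
    (hfeas : ∀ t < T, t ≠ 0 → occ (estKernel Y t) (π t) (startDist N p ρ π t) ∈
      feasibleSet N (estKernel Y t) (startDist N p ρ π t) ρ (bonus N T δ Y t) α) :
    ∑ t ∈ Finset.range T, l1 (startDist N p ρ π t - ρ) ≤
      (1 - α)⁻¹ * (2 * ((1 + N * bonusConst X A N T δ) *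
        ∑ t ∈ Finset.range T, expBonus N T p ρ δ Y π t)) := by
  have hN' : (1 : ℝ) ≤ N := by exact_mod_cast hN
  have hNC : 1 ≤ N * bonusConst X A N T δ := by nlinarith
  have hstep : ∀ t < T, l1 (startDist N p ρ π (t + 1) - ρ) ≤
      2 * ((1 + N * bonusConst X A N T δ) * expBonus N T p ρ δ Y π t) +
        α * l1 (startDist N p ρ π t - ρ) := fun t ht => by
    -- Neither accuracy nor feasibility is available in the first episode, but its expected bonus is
    -- N C ≥ 1, which covers the trivial distance bound 2.
    by_cases ht0 : t = 0
    · subst ht0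
      have h1 := l1_sub_le_two (startDist_mem_stdSimplex hp hρ hπ 1 ht) hρ
      have h2 := mul_nonneg hα0 (l1_nonneg (startDist N p ρ π 0 - ρ))
      rw [expBonus_zero hp hρ (hπ 0 ht)]
      rw [zero_add]
      nlinarith
    · exact l1_startDist_succ_le hp hρ hπ hM ht ht0 (hfeas t ht ht0)
  have h0 : l1 (startDist N p ρ π 0 - ρ) = 0 := by simp [startDist, l1]
  -- Shifting the index is free because the first distance is zero. The recursion can then be summed
  -- and solved for the total.
  have h1 : ∑ t ∈ Finset.range T, l1 (startDist N p ρ π t - ρ) ≤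
      ∑ t ∈ Finset.range T, l1 (startDist N p ρ π (t + 1) - ρ) := by
    have ha := Finset.sum_range_succ (fun t => l1 (startDist N p ρ π t - ρ)) T
    have hb := Finset.sum_range_succ' (fun t => l1 (startDist N p ρ π t - ρ)) T
    have hc := l1_nonneg (startDist N p ρ π T - ρ)
    linarith
  have h2 := h1.trans (Finset.sum_le_sum fun t ht => hstep t (Finset.mem_range.1 ht))
  rw [Finset.sum_add_distrib, ← Finset.mul_sum, ← Finset.mul_sum, ← Finset.mul_sum] at h2
  rw [inv_mul_eq_div, le_div_iff₀ (by linarith)]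
  linarith

/-- Hölder at each of the `N` steps: coefficients at most ℓ + ℓ N C, and distances that the forward
equation does not increase. -/
theorem diffRegret_le_sum_l1 [Nonempty X] {g : ℕ → ℕ → X × A → ℝ} {πc : ℕ → X → A → ℝ}
    (hℓ : 0 ≤ ℓ) (hg : ∀ t < T, ∀ n ∈ Finset.Icc 1 N, ∀ y, |g t n y| ≤ ℓ)
    (hπc : IsPolicy N πc) :
    diffRegret N T p ρ δ ℓ g Y π πc ≤
      N * (ℓ * (1 + N * bonusConst X A N T δ)) *
        ∑ t ∈ Finset.range T, l1 (startDist N p ρ π t - ρ) := by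
  have hC := bonusConst_nonneg (X := X) (A := A) N T δ
  unfold diffRegret
  rw [Finset.mul_sum]
  refine Finset.sum_le_sum fun t ht => ?_
  rw [mul_assoc]
  refine pairing_sub_le (by positivity) (fun n hn y => ?_) fun n hn =>
    l1_occ_sub_occ_le (estKernel_isSubkernel N Y t) hπc _ _ n (Finset.mem_Icc.1 hn).2
  refine (abs_sub _ _).trans ?_
  have h1 := hg t (Finset.mem_range.1 ht) n hn y
  have hn' : (n : ℝ) ≤ N := by exact_mod_cast (Finset.mem_Icc.1 hn).2
  have hn0 : (0 : ℝ) ≤ n := Nat.cast_nonneg n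
  have hb0 := bonus_nonneg N T δ Y t n y
  have h2 : |lossBonus N T δ ℓ Y t n y| ≤ ℓ * N * bonusConst X A N T δ := by
    rw [lossBonus_eq, abs_of_nonneg (mul_nonneg (mul_nonneg hℓ (by linarith)) hb0)]
    exact mul_le_mul (mul_le_mul_of_nonneg_left (by linarith) hℓ) (bonus_le _ _ _ _ _ _ _) hb0
      (by positivity)
  linarith

theorem diffRegret_eq_zero {g : ℕ → ℕ → X × A → ℝ} {πc : ℕ → X → A → ℝ}
    (h : ∀ t < T, startDist N p ρ π t = ρ) : diffRegret N T p ρ δ ℓ g Y π πc = 0 := by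
  refine Finset.sum_eq_zero fun t ht => ?_
  rw [h t (Finset.mem_range.1 ht)]
  simp [pairing]

end Pathwise

/-! ### One-step exponential moments and transition sums. -/

/-- Hoeffding's lemma for a distribution with finite support. -/
theorem sum_mul_exp_le {ι : Type*} [Fintype ι] {q z : ι → ℝ} (hq : q ∈ stdSimplex ℝ ι)
    {a b : ℝ} (hz : ∀ i, z i ∈ Set.Icc a b) (hmean : ∑ i, q i * z i = 0) (c : ℝ) :
    ∑ i, q i * Real.exp (c * z i) ≤ Real.exp (c ^ 2 * (b - a) ^ 2 / 8) := by
  let _ : MeasurableSpace ι := ⊤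
  set ν : Measure ι := ∑ i, ENNReal.ofReal (q i) • Measure.dirac i with hν
  have hint : ∀ h : ι → ℝ, ∫ i, h i ∂ν = ∑ i, q i * h i := fun h => by
    rw [hν, integral_finsetSum_measure]
    · refine Finset.sum_congr rfl fun i _ => ?_
      rw [integral_smul_measure, integral_dirac, ENNReal.toReal_ofReal (hq.1 i), smul_eq_mul]
    · intro i _
      exact (integrable_dirac (by simp)).smul_measure ENNReal.ofReal_ne_top
  have : IsProbabilityMeasure ν := ⟨by
    rw [hν, Measure.finsetSum_apply]
    simp only [Measure.smul_apply, measure_univ, smul_eq_mul, mul_one]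
    rw [← ENNReal.ofReal_sum_of_nonneg fun i _ => hq.1 i, hq.2, ENNReal.ofReal_one]⟩
  have h := (hasSubgaussianMGF_of_mem_Icc_of_integral_eq_zero (μ := ν) (X := z) (a := a) (b := b)
    (measurable_from_top.aemeasurable) (Filter.Eventually.of_forall hz)
    (by rw [hint, hmean])).mgf_le c
  rw [mgf, hint] at h
  refine h.trans_eq ?_
  congr 1
  push_cast
  rw [Real.norm_eq_abs, div_pow, sq_abs]
  ring

theorem sum_stepMatrix_mul {X : Type u} {A : Type v} [Fintype X] [Fintype A] {N n : ℕ}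
    (p : ℕ → X → A → X → ℝ) {π : ℕ → X → A → ℝ} (hπ : IsPolicy N π) (hn : n ∈ Finset.Icc 1 N)
    (y : X × A) (h : X → ℝ) :
    ∑ z, stepMatrix p π n y z * h z.1 = ∑ x, p n y.1 y.2 x * h x := by
  rw [Fintype.sum_prod_type]
  refine Finset.sum_congr rfl fun x _ => ?_
  have hterm : ∀ a, stepMatrix p π n y (x, a) * h x = p n y.1 y.2 x * h x * π n x a := fun a => by
    simp only [stepMatrix, Matrix.of_apply]
    ring
  simp_rw [hterm]
  rw [← Finset.mul_sum, (hπ n hn x).2, mul_one]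

theorem sum_stepMatrix {X : Type u} {A : Type v} [Fintype X] [Fintype A] {N n : ℕ}
    {p : ℕ → X → A → X → ℝ} {π : ℕ → X → A → ℝ} (hp : IsKernel N p) (hπ : IsPolicy N π)
    (hn : n ∈ Finset.Icc 1 N) (y : X × A) : ∑ z, stepMatrix p π n y z = 1 := by
  have h := sum_stepMatrix_mul p hπ hn y fun _ => 1
  simp only [mul_one] at h
  rw [h, (hp n hn _ _).2]

/-! ### Conditional law of successive pairs of a trajectory. -/

section Trajectory

variable {X : Type u} {A : Type v} {Ω : Type w}

/-- The trajectory agrees with `y` at the steps `j, …, k`. -/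
def segment (Z : Ω → ℕ → X × A) (j k : ℕ) (y : ℕ → X × A) : Set Ω :=
  {ω | ∀ n, j ≤ n → n ≤ k → Z ω n = y n}

theorem measurableSet_segment {m : MeasurableSpace Ω} {Z : Ω → ℕ → X × A} {N : ℕ}
    (hZ : ∀ n ≤ N, ∀ y, MeasurableSet {ω | Z ω n = y}) (j : ℕ) {k : ℕ} (hk : k ≤ N)
    (y : ℕ → X × A) : MeasurableSet (segment Z j k y) := by
  have h : segment Z j k y = ⋂ n ∈ Finset.Icc j k, {ω | Z ω n = y n} := by
    ext ω
    simp [segment]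
  rw [h]
  exact Finset.measurableSet_biInter _ fun n hn => hZ n ((Finset.mem_Icc.1 hn).2.trans hk) _

variable [Fintype X] [Fintype A]

theorem indicator_segment_last (Z : Ω → ℕ → X × A) {j k : ℕ} (hjk : j ≤ k + 1) (y : ℕ → X × A) :
    (segment Z j k y).indicator (fun _ => (1 : ℝ)) =
      ∑ v, (segment Z j (k + 1) (Function.update y (k + 1) v)).indicator fun _ => (1 : ℝ) := by
  funext ω
  rw [Finset.sum_apply, Finset.sum_eq_single (Z ω (k + 1))]
  · refine Set.indicator_eq_indicator ?_ rfl
    constructor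
    · intro h n hj hk
      rcases eq_or_ne n (k + 1) with rfl | hne
      · simp
      · rw [Function.update_of_ne hne]
        exact h n hj (by omega)
    · intro h n hj hk
      have := h n hj (by omega)
      rwa [Function.update_of_ne (by omega)] at this
  · intro v _ hv
    refine Set.indicator_of_notMem (fun h => hv ?_) _
    simpa using (h (k + 1) hjk le_rfl).symm
  · simp

theorem indicator_segment_first (Z : Ω → ℕ → X × A) {j k : ℕ} (hjk : j ≤ k) (y : ℕ → X × A) :
    (segment Z (j + 1) k y).indicator (fun _ => (1 : ℝ)) =
      ∑ v, (segment Z j k (Function.update y j v)).indicator fun _ => (1 : ℝ) := by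
  funext ω
  rw [Finset.sum_apply, Finset.sum_eq_single (Z ω j)]
  · refine Set.indicator_eq_indicator ?_ rfl
    constructor
    · intro h n hj hk
      rcases eq_or_ne n j with rfl | hne
      · simp
      · rw [Function.update_of_ne hne]
        exact h n (by omega) hk
    · intro h n hj hk
      have := h n (by omega) hk
      rwa [Function.update_of_ne (by omega)] at this
  · intro v _ hv
    refine Set.indicator_of_notMem (fun h => hv ?_) _
    simpa using (h j le_rfl hjk).symm
  · simp

variable {m mΩ : MeasurableSpace Ω} {P : Measure Ω} [IsProbabilityMeasure P] {N : ℕ}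
  {p : ℕ → X → A → X → ℝ} {Z : Ω → ℕ → X × A} {π : Ω → ℕ → X → A → ℝ} {ν : Ω → X × A → ℝ}

/-- Sum out the last pair, whose transition row has mass one; the induction runs backwards from the
full trajectory, `d` being the number of pairs removed. -/
theorem condExp_prefix (hp : IsKernel N p) (hπ : ∀ ω, IsPolicy N (π ω))
    (hZ : ∀ n ≤ N, ∀ y, MeasurableSet {ω | Z ω n = y})
    (hlaw : ∀ y : ℕ → X × A, P[(segment Z 0 N y).indicator (fun _ => (1 : ℝ)) | m] =ᵐ[P]
      fun ω => trajProb N p (π ω) (ν ω) y) (d : ℕ) :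
    ∀ k, k + d = N → ∀ y : ℕ → X × A,
      P[(segment Z 0 k y).indicator (fun _ => (1 : ℝ)) | m] =ᵐ[P]
        fun ω => trajProb k p (π ω) (ν ω) y := by
  induction d with
  | zero =>
    intro k hk y
    rw [add_zero] at hk
    exact hk ▸ hlaw y
  | succ d ih =>
    intro k hk y
    rw [indicator_segment_last Z (by omega)]
    refine (condExp_finsetSum (fun v _ => (integrable_const (1 : ℝ)).indicator
      (measurableSet_segment hZ 0 (by omega) _)) m).trans ?_
    have hall : ∀ᵐ ω ∂P, ∀ v : X × A, P[(segment Z 0 (k + 1) (Function.update y (k + 1)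
        v)).indicator (fun _ => (1 : ℝ)) | m] ω =
          trajProb (k + 1) p (π ω) (ν ω) (Function.update y (k + 1) v) :=
      ae_all_iff.2 fun v => ih (k + 1) (by omega) _
    filter_upwards [hall] with ω hω
    rw [Finset.sum_apply, Finset.sum_congr rfl fun v _ => hω v]
    have hterm : ∀ v, trajProb (k + 1) p (π ω) (ν ω) (Function.update y (k + 1) v) =
        trajProb k p (π ω) (ν ω) y * stepMatrix p (π ω) (k + 1) (y k) v := fun v => by
      unfold trajProb
      rw [Finset.prod_range_succ, ← mul_assoc, Function.update_self,
        Function.update_of_ne (by omega), Function.update_of_ne (by omega)]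
      congr 2
      refine Finset.prod_congr rfl fun n hn => ?_
      have := Finset.mem_range.1 hn
      rw [Function.update_of_ne (by omega), Function.update_of_ne (by omega)]
    simp_rw [hterm]
    rw [← Finset.mul_sum, sum_stepMatrix hp (hπ ω) (Finset.mem_Icc.2 ⟨by omega, by omega⟩),
      mul_one]

/-- Summing out the first pair of a segment reproduces the forward equation for `occ`. -/
theorem condExp_segment (hp : IsKernel N p) (hπ : ∀ ω, IsPolicy N (π ω))
    (hZ : ∀ n ≤ N, ∀ y, MeasurableSet {ω | Z ω n = y})
    (hlaw : ∀ y : ℕ → X × A, P[(segment Z 0 N y).indicator (fun _ => (1 : ℝ)) | m] =ᵐ[P]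
      fun ω => trajProb N p (π ω) (ν ω) y) {k : ℕ} (hk : k ≤ N) (j : ℕ) :
    j ≤ k → ∀ y : ℕ → X × A, P[(segment Z j k y).indicator (fun _ => (1 : ℝ)) | m] =ᵐ[P]
      fun ω => occ p (π ω) (ν ω) j (y j) *
        ∏ n ∈ Finset.Ico j k, stepMatrix p (π ω) (n + 1) (y n) (y (n + 1)) := by
  induction j with
  | zero =>
    intro _ y
    have h := condExp_prefix hp hπ hZ hlaw (N - k) k (by omega) y
    simpa only [trajProb, occ, Nat.Ico_zero_eq_range] using h
  | succ j ih =>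
    intro hj y
    rw [indicator_segment_first Z (by omega)]
    refine (condExp_finsetSum (fun v _ => (integrable_const (1 : ℝ)).indicator
      (measurableSet_segment hZ j hk _)) m).trans ?_
    have hall := ae_all_iff.2 fun v : X × A => ih (by omega) (Function.update y j v)
    filter_upwards [hall] with ω hω
    rw [Finset.sum_apply, Finset.sum_congr rfl fun v _ => hω v, occ, Finset.sum_mul]
    refine Finset.sum_congr rfl fun v _ => ?_
    rw [Finset.prod_eq_prod_Ico_succ_bot (by omega), Function.update_self,
      Function.update_of_ne (by omega), ← mul_assoc]
    congr 1
    · simp [stepMatrix, mul_assoc]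
    · refine Finset.prod_congr rfl fun n hn => ?_
      have := (Finset.mem_Ico.1 hn).1
      rw [Function.update_of_ne (by omega), Function.update_of_ne (by omega)]

/-- The conditional law of two successive pairs of a trajectory. -/
theorem condExp_transition (hp : IsKernel N p) (hπ : ∀ ω, IsPolicy N (π ω))
    (hZ : ∀ n ≤ N, ∀ y, MeasurableSet {ω | Z ω n = y})
    (hlaw : ∀ y : ℕ → X × A, P[(segment Z 0 N y).indicator (fun _ => (1 : ℝ)) | m] =ᵐ[P]
      fun ω => trajProb N p (π ω) (ν ω) y) {n : ℕ} (hn : n < N) (u v : X × A) :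
    P[({ω | Z ω n = u ∧ Z ω (n + 1) = v}).indicator (fun _ => (1 : ℝ)) | m] =ᵐ[P]
      fun ω => occ p (π ω) (ν ω) n u * stepMatrix p (π ω) (n + 1) u v := by
  have h := condExp_segment hp hπ hZ hlaw (k := n + 1) hn n (by omega)
    (fun i => if i = n then u else v)
  have hset : segment Z n (n + 1) (fun i => if i = n then u else v) =
      {ω | Z ω n = u ∧ Z ω (n + 1) = v} := by
    ext ω
    constructor
    · intro h
      exact ⟨by simpa using h n le_rfl (by omega), by simpa using h (n + 1) (by omega) le_rfl⟩
    · rintro ⟨h1, h2⟩ i hi1 hi2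
      rcases eq_or_ne i n with rfl | hne
      · simpa using h1
      · obtain rfl : i = n + 1 := by omega
        simpa using h2
  rw [hset] at h
  simpa using h

/-- Expand over the finitely many values of the two pairs; for fixed values the coefficient is known
given the past and comes out of the conditional expectation. -/
theorem integral_transition (hm : m ≤ mΩ) (hp : IsKernel N p) (hπ : ∀ ω, IsPolicy N (π ω))
    (hZ : ∀ n ≤ N, ∀ y, MeasurableSet {ω | Z ω n = y})
    (hlaw : ∀ y : ℕ → X × A, P[(segment Z 0 N y).indicator (fun _ => (1 : ℝ)) | m] =ᵐ[P]
      fun ω => trajProb N p (π ω) (ν ω) y) {n : ℕ} (hn : n < N)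
    {G : Ω → X × A → X × A → ℝ} {B : ℝ} (hG : ∀ u v, Measurable[m] fun ω => G ω u v)
    (hB : ∀ ω u v, |G ω u v| ≤ B) :
    ∫ ω, G ω (Z ω n) (Z ω (n + 1)) ∂P =
      ∫ ω, ∑ u, ∑ v, occ p (π ω) (ν ω) n u * stepMatrix p (π ω) (n + 1) u v * G ω u v ∂P := by
  set I : X × A → X × A → Ω → ℝ := fun u v =>
    ({ω | Z ω n = u ∧ Z ω (n + 1) = v}).indicator (fun _ => (1 : ℝ)) with hI
  have hImeas : ∀ u v, MeasurableSet {ω | Z ω n = u ∧ Z ω (n + 1) = v} := fun u v =>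
    (hZ n hn.le u).inter (hZ (n + 1) hn v)
  have hIint : ∀ u v, Integrable (I u v) P := fun u v =>
    (integrable_const (1 : ℝ)).indicator (hImeas u v)
  have hpull : ∀ u v, P[(fun ω => G ω u v) * I u v | m] =ᵐ[P] fun ω =>
      occ p (π ω) (ν ω) n u * stepMatrix p (π ω) (n + 1) u v * G ω u v := fun u v => by
    refine (condExp_stronglyMeasurable_mul_of_bound hm (hG u v).stronglyMeasurable (hIint u v) B
      (Filter.Eventually.of_forall fun ω => hB ω u v)).trans ?_
    filter_upwards [condExp_transition hp hπ hZ hlaw hn u v] with ω hω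
    rw [Pi.mul_apply, hω, mul_comm]
  have hGI : ∀ u v, Integrable ((fun ω => G ω u v) * I u v) P := fun u v =>
    (hIint u v).bdd_mul ((hG u v).mono hm le_rfl).aestronglyMeasurable
      (Filter.Eventually.of_forall fun ω => hB ω u v)
  have hleft : ∀ ω, G ω (Z ω n) (Z ω (n + 1)) = ∑ u, ∑ v, ((fun ω => G ω u v) * I u v) ω :=
    fun ω => by
      rw [Finset.sum_eq_single (Z ω n), Finset.sum_eq_single (Z ω (n + 1))]
      · simp [hI]
      · intro v _ hv
        simp [hI, hv.symm]
      · simp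
      · intro u _ hu
        simp [hI, hu.symm]
      · simp
  simp_rw [hleft]
  rw [integral_finsetSum _ fun u _ => integrable_finsetSum _ fun v _ => hGI u v,
    integral_finsetSum _ fun u _ => integrable_finsetSum _ fun v _ =>
      integrable_condExp.congr (hpull u v)]
  refine Finset.sum_congr rfl fun u _ => ?_
  rw [integral_finsetSum _ fun v _ => hGI u v,
    integral_finsetSum _ fun v _ => integrable_condExp.congr (hpull u v)]
  refine Finset.sum_congr rfl fun v _ => ?_
  rw [← integral_condExp hm]
  exact integral_congr_ae (hpull u v)

end Trajectory

theorem measurable_occ {X : Type u} {A : Type v} {Ω : Type w} [Fintype X] [Fintype A]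
    {m : MeasurableSpace Ω} {N : ℕ} (p : ℕ → X → A → X → ℝ) {π : Ω → ℕ → X → A → ℝ}
    {ν : Ω → X × A → ℝ} (hπ : ∀ n ∈ Finset.Icc 1 N, ∀ x a, Measurable fun ω => π ω n x a)
    (hν : ∀ y, Measurable fun ω => ν ω y) :
    ∀ n ≤ N, ∀ y, Measurable fun ω => occ p (π ω) (ν ω) n y
  | 0, _, y => hν y
  | n + 1, hn, y => Finset.measurable_fun_sum _ fun y' _ =>
      ((measurable_occ p hπ hν n (by omega) y').mul_const _).mul
        (hπ _ (Finset.mem_Icc.2 ⟨by omega, hn⟩) _ _)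

/-! ### Exponential supermartingales and Azuma's inequality. -/

section Run

variable {X : Type u} {A : Type v} [Fintype X] [Fintype A] [DecidableEq X] [DecidableEq A]
  {Ω : Type w} [mΩ : MeasurableSpace Ω] {P : Measure Ω} {𝓕 : Filtration ℕ mΩ} {N T : ℕ}
  {p : ℕ → X → A → X → ℝ} {ρ : X × A → ℝ} {α δ ℓ η : ℝ}
  {D : (Fin (N + 1) → X × A → ℝ) → (Fin (N + 1) → X × A → ℝ) → ℝ}
  {f : ℕ → Ω → ℕ → (X × A → ℝ) → ℝ} {g : ℕ → Ω → ℕ → X × A → ℝ}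
  {Y : ℕ → Ω → ℕ → X × A} {π : ℕ → Ω → ℕ → X → A → ℝ}

theorem measurable_startDist (hrun : IsRun P 𝓕 N T p ρ α δ ℓ η D f g Y π) :
    ∀ t ≤ T, ∀ y, Measurable[𝓕 t] fun ω => startDist N p ρ (fun s => π s ω) t y
  | 0, _, y => measurable_const
  | t + 1, ht, y => by
      simp_rw [startDist_succ_eq]
      exact (measurable_occ p (hrun.policy_adapted t ht)
        (measurable_startDist hrun t (by omega)) N le_rfl y).mono (𝓕.mono t.le_succ) le_rfl

theorem measurable_visits (hrun : IsRun P 𝓕 N T p ρ α δ ℓ η D f g Y π) {n : ℕ} (hn : n ≤ N)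
    (y : X × A) : ∀ t ≤ T, Measurable[𝓕 t] fun ω => visits (fun s => Y s ω) t n y
  | 0, _ => by simp [visits]
  | t + 1, ht => by
      simp_rw [visits_succ]
      exact ((measurable_visits hrun hn y t (by omega)).mono (𝓕.mono t.le_succ) le_rfl).add
        (Measurable.ite (hrun.traj_adapted t ht n hn y) measurable_const measurable_const)

theorem measurable_bonus (hrun : IsRun P 𝓕 N T p ρ α δ ℓ η D f g Y π) {n : ℕ} (hn : n ≤ N)
    (y : X × A) {t : ℕ} (ht : t ≤ T) :
    Measurable[𝓕 t] fun ω => bonus N T δ (fun s => Y s ω) t n y :=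
  (measurable_from_top (f := fun k : ℕ => bonusConst X A N T δ / √(max 1 (k : ℝ)))).comp
    (measurable_visits hrun hn y t ht)

/-- The factors of an exponential supermartingale along the transitions at step `n`, and their
conditional expectations given the past. -/
structure IsFactor (𝓕 : Filtration ℕ mΩ) (N T : ℕ) (p : ℕ → X → A → X → ℝ) (ρ : X × A → ℝ)
    (π : ℕ → Ω → ℕ → X → A → ℝ) (n : ℕ) (Φ : ℕ → Ω → X × A → X × A → ℝ) (B : ℝ) : Prop where
  measurable : ∀ t < T, ∀ u v, Measurable[𝓕 t] fun ω => Φ t ω u v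
  nonneg : ∀ t < T, ∀ ω u v, 0 ≤ Φ t ω u v
  le_bound : ∀ t < T, ∀ ω u v, Φ t ω u v ≤ B
  sum_le : ∀ t < T, ∀ ω, ∑ u, ∑ v,
    occ p (π t ω) (startDist N p ρ (fun s => π s ω) t) n u *
      stepMatrix p (π t ω) (n + 1) u v * Φ t ω u v ≤ 1

variable {n : ℕ} {Φ : ℕ → Ω → X × A → X × A → ℝ} {B : ℝ}

theorem IsFactor.measurable_prod (hΦ : IsFactor 𝓕 N T p ρ π n Φ B)
    (hrun : IsRun P 𝓕 N T p ρ α δ ℓ η D f g Y π) (hn : n < N) : ∀ t ≤ T,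
      Measurable[𝓕 t] fun ω => ∏ s ∈ Finset.range t, Φ s ω (Y s ω n) (Y s ω (n + 1))
  | 0, _ => by simp
  | t + 1, ht => by
      simp_rw [Finset.prod_range_succ]
      refine ((hΦ.measurable_prod hrun hn t (by omega)).mono (𝓕.mono t.le_succ) le_rfl).mul ?_
      have h : (fun ω => Φ t ω (Y t ω n) (Y t ω (n + 1))) = fun ω => ∑ u, ∑ v,
          ({ω | Y t ω n = u} ∩ {ω | Y t ω (n + 1) = v}).indicator (fun ω => Φ t ω u v) ω := by
        funext ω
        rw [Finset.sum_eq_single (Y t ω n), Finset.sum_eq_single (Y t ω (n + 1))]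
        · simp
        · intro v _ hv
          simp [hv.symm]
        · simp
        · intro u _ hu
          simp [hu.symm]
        · simp
      rw [h]
      exact Finset.measurable_fun_sum _ fun u _ => Finset.measurable_fun_sum _ fun v _ =>
        ((hΦ.measurable t ht u v).mono (𝓕.mono t.le_succ) le_rfl).indicator
          ((hrun.traj_adapted t ht n hn.le u).inter (hrun.traj_adapted t ht (n + 1) hn v))

theorem IsFactor.prod_nonneg (hΦ : IsFactor 𝓕 N T p ρ π n Φ B) {t : ℕ} (ht : t ≤ T) (ω : Ω) :
    0 ≤ ∏ s ∈ Finset.range t, Φ s ω (Y s ω n) (Y s ω (n + 1)) :=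
  Finset.prod_nonneg fun s hs => hΦ.nonneg s ((Finset.mem_range.1 hs).trans_le ht) _ _ _

theorem IsFactor.prod_le (hΦ : IsFactor 𝓕 N T p ρ π n Φ B) {t : ℕ} (ht : t ≤ T) (ω : Ω) :
    ∏ s ∈ Finset.range t, Φ s ω (Y s ω n) (Y s ω (n + 1)) ≤ B ^ t := by
  refine (Finset.prod_le_prod (fun s hs => hΦ.nonneg s ((Finset.mem_range.1 hs).trans_le ht) _ _ _)
    fun s hs => hΦ.le_bound s ((Finset.mem_range.1 hs).trans_le ht) _ _ _).trans_eq ?_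
  simp

variable [IsProbabilityMeasure P]

theorem IsFactor.integrable_prod (hΦ : IsFactor 𝓕 N T p ρ π n Φ B)
    (hrun : IsRun P 𝓕 N T p ρ α δ ℓ η D f g Y π) (hn : n < N) {t : ℕ} (ht : t ≤ T) :
    Integrable (fun ω => ∏ s ∈ Finset.range t, Φ s ω (Y s ω n) (Y s ω (n + 1))) P :=
  Integrable.of_bound ((hΦ.measurable_prod hrun hn t ht).mono (𝓕.le t) le_rfl).aestronglyMeasurable
    (B ^ t) (Filter.Eventually.of_forall fun ω => by
      rw [Real.norm_eq_abs, abs_of_nonneg (hΦ.prod_nonneg ht ω)]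
      exact hΦ.prod_le ht ω)

theorem IsFactor.integral_prod_le_one (hΦ : IsFactor 𝓕 N T p ρ π n Φ B) (hp : IsKernel N p)
    (hrun : IsRun P 𝓕 N T p ρ α δ ℓ η D f g Y π) (hn : n < N) : ∀ t ≤ T,
      ∫ ω, ∏ s ∈ Finset.range t, Φ s ω (Y s ω n) (Y s ω (n + 1)) ∂P ≤ 1
  | 0, _ => by simp
  | t + 1, ht => by
      have ht' : t ≤ T := by omega
      set W : Ω → ℝ := fun ω => ∏ s ∈ Finset.range t, Φ s ω (Y s ω n) (Y s ω (n + 1)) with hW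
      have hW0 : ∀ ω, 0 ≤ W ω := fun ω => hΦ.prod_nonneg ht' ω
      have heq := integral_transition (G := fun ω u v => W ω * Φ t ω u v) (B := B ^ t * B)
        (𝓕.le t) hp (hrun.policy t ht)
        (fun k hk y => 𝓕.le _ _ (hrun.traj_adapted t ht k hk y))
        (fun y => by simpa [segment] using hrun.traj_law t ht y) hn
        (fun u v => (hΦ.measurable_prod hrun hn t ht').mul (hΦ.measurable t ht u v))
        (fun ω u v => by
          rw [abs_of_nonneg (mul_nonneg (hW0 ω) (hΦ.nonneg t ht ω u v))]
          exact mul_le_mul (hΦ.prod_le ht' ω) (hΦ.le_bound t ht ω u v) (hΦ.nonneg t ht ω u v)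
            ((hW0 ω).trans (hΦ.prod_le ht' ω)))
      simp_rw [Finset.prod_range_succ]
      refine heq.le.trans (le_trans ?_ (hΦ.integral_prod_le_one hp hrun hn t ht'))
      by_cases hint : Integrable (fun ω => ∑ u, ∑ v,
          occ p (π t ω) (startDist N p ρ (fun s => π s ω) t) n u *
            stepMatrix p (π t ω) (n + 1) u v * (W ω * Φ t ω u v)) P
      · refine integral_mono hint (hΦ.integrable_prod hrun hn ht') fun ω => ?_
        have h := mul_le_mul_of_nonneg_left (hΦ.sum_le t ht ω) (hW0 ω)
        rw [mul_one, Finset.mul_sum] at h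
        refine le_trans (le_of_eq ?_) h
        refine Finset.sum_congr rfl fun u _ => ?_
        rw [Finset.mul_sum]
        exact Finset.sum_congr rfl fun v _ => by ring
      -- A nonintegrable function has integral 0 by convention, which suffices here.
      · rw [integral_undef hint]
        exact integral_nonneg hW0

/-- Markov's inequality for a nonnegative product of mean at most one. -/
theorem IsFactor.measure_le (hΦ : IsFactor 𝓕 N T p ρ π n Φ B) (hp : IsKernel N p)
    (hrun : IsRun P 𝓕 N T p ρ α δ ℓ η D f g Y π) (hn : n < N) (c : ℝ) :
    P {ω | Real.exp c ≤ ∏ s ∈ Finset.range T, Φ s ω (Y s ω n) (Y s ω (n + 1))} ≤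
      ENNReal.ofReal (Real.exp (-c)) := by
  have h := mul_meas_ge_le_integral_of_nonneg (μ := P)
    (Filter.Eventually.of_forall fun ω => hΦ.prod_nonneg (Y := Y) le_rfl ω)
    (hΦ.integrable_prod hrun hn le_rfl) (Real.exp c)
  have h' := h.trans (hΦ.integral_prod_le_one hp hrun hn T le_rfl)
  rw [← ENNReal.ofReal_toReal (measure_ne_top P _)]
  refine ENNReal.ofReal_le_ofReal ?_
  rw [Real.exp_neg, ← one_div, le_div_iff₀' (Real.exp_pos c)]
  exact h'

/-- Azuma's inequality for the bonuses collected at step `n`. -/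
theorem measure_sum_bonus_le (hp : IsKernel N p) (hρ : ρ ∈ stdSimplex ℝ (X × A))
    (hrun : IsRun P 𝓕 N T p ρ α δ ℓ η D f g Y π) (hn : n < N) {c : ℝ} (hc : 0 ≤ c) (r : ℝ) :
    P {ω | r < ∑ t ∈ Finset.range T,
        (∑ y, occ p (π t ω) (startDist N p ρ (fun s => π s ω) t) n y *
            bonus N T δ (fun s => Y s ω) t n y - bonus N T δ (fun s => Y s ω) t n (Y t ω n))} ≤
      ENNReal.ofReal (Real.exp (-(c * r - T * (c ^ 2 * bonusConst X A N T δ ^ 2 / 8)))) := by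
  set C := bonusConst X A N T δ with hC
  have hC0 : 0 ≤ C := bonusConst_nonneg N T δ
  set b : ℕ → Ω → X × A → ℝ := fun t ω y => bonus N T δ (fun s => Y s ω) t n y with hb
  set o : ℕ → Ω → X × A → ℝ :=
    fun t ω => occ p (π t ω) (startDist N p ρ (fun s => π s ω) t) n with ho
  set E : ℕ → Ω → ℝ := fun t ω => ∑ y, o t ω y * b t ω y with hE
  have hb0 : ∀ t ω y, 0 ≤ b t ω y := fun t ω y => bonus_nonneg _ _ _ _ _ _ _
  have hbC : ∀ t ω y, b t ω y ≤ C := fun t ω y => bonus_le _ _ _ _ _ _ _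
  have hos : ∀ t < T, ∀ ω, o t ω ∈ stdSimplex ℝ (X × A) := fun t ht ω =>
    occ_mem_stdSimplex hp (hrun.policy t ht ω) (startDist_mem_stdSimplex hp hρ
      (fun s hs => hrun.policy s hs ω) t ht.le) n hn.le
  have hom : ∀ t < T, ∀ y, Measurable[𝓕 t] fun ω => o t ω y := fun t ht y =>
    measurable_occ p (hrun.policy_adapted t ht) (measurable_startDist hrun t ht.le) n hn.le y
  have hbm : ∀ t < T, ∀ y, Measurable[𝓕 t] fun ω => b t ω y := fun t ht y =>
    measurable_bonus hrun hn.le y ht.le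
  have hEC : ∀ t < T, ∀ ω, E t ω ≤ C := fun t ht ω => by
    refine (Finset.sum_le_sum fun y _ =>
      mul_le_mul_of_nonneg_left (hbC t ω y) ((hos t ht ω).1 y)).trans_eq ?_
    rw [← Finset.sum_mul, (hos t ht ω).2, one_mul]
  -- Bonuses lie in [0, C], so the centred bonus ranges over an interval of length C and Hoeffding's
  -- lemma gives the compensator c²C²/8.
  have hfac : IsFactor 𝓕 N T p ρ π n
      (fun t ω u _ => Real.exp (c * (E t ω - b t ω u) - c ^ 2 * C ^ 2 / 8))
      (Real.exp (c * C)) :=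
    { measurable := fun t ht u v => by
        have hEm : Measurable[𝓕 t] (E t) :=
          Finset.measurable_fun_sum _ fun y _ => (hom t ht y).mul (hbm t ht y)
        exact (((hEm.sub (hbm t ht u)).const_mul c).sub_const _).exp
      nonneg := fun t _ ω u v => (Real.exp_pos _).le
      le_bound := fun t ht ω u v => by
        refine Real.exp_le_exp.2 ?_
        have h1 := mul_le_mul_of_nonneg_left
          (show E t ω - b t ω u ≤ C by linarith [hEC t ht ω, hb0 t ω u]) hc
        have h2 : 0 ≤ c ^ 2 * C ^ 2 / 8 := by positivity
        linarith
      sum_le := fun t ht ω => by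
        have hH := sum_mul_exp_le (z := fun u => E t ω - b t ω u) (hos t ht ω)
          (a := E t ω - C) (b := E t ω)
          (fun u => ⟨by linarith [hbC t ω u], by linarith [hb0 t ω u]⟩)
          (by
            simp_rw [mul_sub]
            rw [Finset.sum_sub_distrib, ← Finset.sum_mul, (hos t ht ω).2, one_mul]
            exact sub_self _) c
        rw [sub_sub_cancel] at hH
        have hinner : ∀ u, ∑ v, o t ω u * stepMatrix p (π t ω) (n + 1) u v *
            Real.exp (c * (E t ω - b t ω u) - c ^ 2 * C ^ 2 / 8) =
            o t ω u * Real.exp (c * (E t ω - b t ω u)) / Real.exp (c ^ 2 * C ^ 2 / 8) :=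
          fun u => by
            rw [← Finset.sum_mul, ← Finset.mul_sum, sum_stepMatrix hp (hrun.policy t ht ω)
              (Finset.mem_Icc.2 ⟨by omega, hn⟩), mul_one, Real.exp_sub]
            ring
        rw [Finset.sum_congr rfl fun u _ => hinner u, ← Finset.sum_div]
        exact div_le_one_of_le₀ hH (Real.exp_pos _).le }
  refine (measure_mono fun ω hω => ?_).trans (hfac.measure_le hp hrun hn _)
  rw [Set.mem_ofPred_eq, ← Real.exp_sum, Real.exp_le_exp, Finset.sum_sub_distrib, ← Finset.mul_sum]
  have := mul_le_mul_of_nonneg_left (le_of_lt hω) hc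
  simp only [Finset.sum_const, Finset.card_range, nsmul_eq_mul]
  linarith

end Run

/-! ### Transition counts stopped after a given number of visits. -/

section Counting

variable {X : Type u} {A : Type v} [DecidableEq X] [DecidableEq A]

theorem transitions_succ (Y : ℕ → ℕ → X × A) (t n : ℕ) (y : X × A) (x : X) :
    transitions Y (t + 1) n y x =
      transitions Y t n y x + if Y t n = y ∧ (Y t (n + 1)).1 = x then 1 else 0 := by
  unfold transitions
  rw [Finset.range_add_one, Finset.filter_insert]
  split_ifs with h
  · rw [Finset.card_insert_of_notMem (by simp)]
  · rfl

theorem visits_mono (Y : ℕ → ℕ → X × A) (n : ℕ) (y : X × A) :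
    Monotone fun t => visits Y t n y :=
  monotone_nat_of_le_succ fun t => by
    rw [visits_succ]
    exact Nat.le_add_right _ _

theorem visits_le (Y : ℕ → ℕ → X × A) (t n : ℕ) (y : X × A) : visits Y t n y ≤ t :=
  (Finset.card_filter_le (Finset.range t) fun s => Y s n = y).trans_eq (Finset.card_range t)

variable [Fintype X]

/-- Deviation of the observed transitions from `y` at step `n`, tested against `s`. -/
def deviation (p : ℕ → X → A → X → ℝ) (s : X → ℝ) (Y : ℕ → ℕ → X × A) (t n : ℕ) (y : X × A) : ℝ :=
  ∑ x, s x * (transitions Y t n y x - visits Y t n y * p (n + 1) y.1 y.2 x)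

theorem deviation_succ (p : ℕ → X → A → X → ℝ) (s : X → ℝ) (Y : ℕ → ℕ → X × A) (t n : ℕ)
    (y : X × A) : deviation p s Y (t + 1) n y = deviation p s Y t n y +
      if Y t n = y then s (Y t (n + 1)).1 - ∑ x, p (n + 1) y.1 y.2 x * s x else 0 := by
  unfold deviation
  have h : ∀ x, s x * ((transitions Y (t + 1) n y x : ℝ) -
      visits Y (t + 1) n y * p (n + 1) y.1 y.2 x) =
      s x * (transitions Y t n y x - visits Y t n y * p (n + 1) y.1 y.2 x) +
        if Y t n = y then (if (Y t (n + 1)).1 = x then s x else 0) - p (n + 1) y.1 y.2 x * s x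
        else 0 := fun x => by
    rw [transitions_succ, visits_succ]
    by_cases h1 : Y t n = y <;> by_cases h2 : (Y t (n + 1)).1 = x <;> simp [h1, h2] <;> ring
  simp_rw [h]
  rw [Finset.sum_add_distrib]
  split_ifs with h1
  · rw [Finset.sum_sub_distrib]
    simp
  · simp

/-- Factors of the exponential supermartingale for the first `m` visits of `y`. -/
noncomputable def visitFactor (p : ℕ → X → A → X → ℝ) (s : X → ℝ) (ε : ℝ) (m n : ℕ) (y : X × A)
    (Y : ℕ → ℕ → X × A) (t : ℕ) (u v : X × A) : ℝ :=
  if u = y ∧ visits Y t n y < m then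
    Real.exp (ε * (s v.1 - ∑ x, p (n + 1) y.1 y.2 x * s x) - ε ^ 2 / 2) else 1

theorem prod_visitFactor (p : ℕ → X → A → X → ℝ) (s : X → ℝ) (ε : ℝ) (m n : ℕ) (y : X × A)
    (Y : ℕ → ℕ → X × A) (t : ℕ) (ht : visits Y t n y ≤ m) :
    ∏ i ∈ Finset.range t, visitFactor p s ε m n y Y i (Y i n) (Y i (n + 1)) =
      Real.exp (ε * deviation p s Y t n y - visits Y t n y * (ε ^ 2 / 2)) := by
  induction t with
  | zero => simp [visits, deviation, transitions]
  | succ t ih =>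
    have hv := visits_succ Y t n y
    rw [Finset.prod_range_succ, ih (by omega), deviation_succ, hv, visitFactor]
    by_cases h : Y t n = y
    · rw [if_pos h] at hv
      simp only [h, true_and, if_true]
      rw [if_pos (by omega), ← Real.exp_add]
      congr 1
      push_cast
      ring
    · simp [h]

/-- From episode `t` on, the count has reached the cutoff and every factor is 1. The terminal
product thus records the deviation at `t`, so one tail bound covers all `t` with the same visit
count. -/
theorem prod_visitFactor_eq (p : ℕ → X → A → X → ℝ) (s : X → ℝ) (ε : ℝ) (n : ℕ) (y : X × A)
    (Y : ℕ → ℕ → X × A) {t T : ℕ} (htT : t ≤ T) :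
    ∏ i ∈ Finset.range T, visitFactor p s ε (visits Y t n y) n y Y i (Y i n) (Y i (n + 1)) =
      Real.exp (ε * deviation p s Y t n y - visits Y t n y * (ε ^ 2 / 2)) := by
  rw [← prod_visitFactor p s ε _ n y Y t le_rfl, ← Finset.prod_range_mul_prod_Ico _ htT]
  refine mul_right_eq_self₀.2 (Or.inl (Finset.prod_eq_one fun i hi => if_neg fun h => ?_))
  exact absurd (visits_mono Y n y (Finset.mem_Ico.1 hi).1) (not_le.2 h.2)

end Counting

/-! ### Concentration of the empirical kernel. -/

section Run

variable {X : Type u} {A : Type v} [Fintype X] [Fintype A] [DecidableEq X] [DecidableEq A]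
  {Ω : Type w} [mΩ : MeasurableSpace Ω] {P : Measure Ω} {𝓕 : Filtration ℕ mΩ} {N T : ℕ}
  {p : ℕ → X → A → X → ℝ} {ρ : X × A → ℝ} {α δ ℓ η : ℝ}
  {D : (Fin (N + 1) → X × A → ℝ) → (Fin (N + 1) → X × A → ℝ) → ℝ}
  {f : ℕ → Ω → ℕ → (X × A → ℝ) → ℝ} {g : ℕ → Ω → ℕ → X × A → ℝ}
  {Y : ℕ → Ω → ℕ → X × A} {π : ℕ → Ω → ℕ → X → A → ℝ} {n : ℕ}

theorem isFactor_visitFactor (hp : IsKernel N p) (hρ : ρ ∈ stdSimplex ℝ (X × A))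
    (hrun : IsRun P 𝓕 N T p ρ α δ ℓ η D f g Y π) (hn : n < N) {s : X → ℝ}
    (hs : ∀ x, |s x| ≤ 1) {ε : ℝ} (hε : 0 ≤ ε) (m : ℕ) (y : X × A) :
    IsFactor 𝓕 N T p ρ π n (fun t ω => visitFactor p s ε m n y (fun i => Y i ω) t)
      (Real.exp (2 * ε)) := by
  have hnI : n + 1 ∈ Finset.Icc 1 N := Finset.mem_Icc.2 ⟨by omega, hn⟩
  have hpy := hp _ hnI y.1 y.2
  set M : ℝ := ∑ x, p (n + 1) y.1 y.2 x * s x with hM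
  have hM1 : |M| ≤ 1 := by
    rw [← hpy.2]
    refine (Finset.abs_sum_le_sum_abs _ _).trans (Finset.sum_le_sum fun x _ => ?_)
    rw [abs_mul, abs_of_nonneg (hpy.1 x)]
    exact mul_le_of_le_one_right (hpy.1 x) (hs x)
  constructor
  · intro t ht u v
    unfold visitFactor
    refine Measurable.ite (MeasurableSet.inter (MeasurableSet.const _) ?_) measurable_const
      measurable_const
    exact measurable_visits hrun hn.le y t ht.le (MeasurableSet.of_discrete (s := {k | k < m}))
  · intro t _ ω u v
    unfold visitFactor
    split_ifs
    · exact (Real.exp_pos _).le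
    · exact zero_le_one
  · intro t _ ω u v
    unfold visitFactor
    split_ifs
    · refine Real.exp_le_exp.2 ?_
      have h1 := (abs_le.1 (hs v.1)).2
      have h2 := (abs_le.1 hM1).1
      nlinarith [sq_nonneg ε, mul_le_mul_of_nonneg_left (show s v.1 - M ≤ 2 by linarith) hε]
    · exact Real.one_le_exp (by linarith)
  · intro t ht ω
    have ho := occ_mem_stdSimplex hp (hrun.policy t ht ω) (startDist_mem_stdSimplex hp hρ
      (fun s hs => hrun.policy s hs ω) t ht.le) n hn.le
    rw [← ho.2]
    refine Finset.sum_le_sum fun u _ => ?_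
    simp_rw [mul_assoc]
    rw [← Finset.mul_sum]
    refine mul_le_of_le_one_right (ho.1 u) ?_
    unfold visitFactor
    by_cases h : u = y ∧ visits (fun i => Y i ω) t n y < m
    · simp only [h, and_self, if_true]
      rw [sum_stepMatrix_mul p (hrun.policy t ht ω) hnI y
        fun x => Real.exp (ε * (s x - M) - ε ^ 2 / 2)]
      simp_rw [Real.exp_sub _ (ε ^ 2 / 2), ← mul_div_assoc]
      rw [← Finset.sum_div]
      refine div_le_one_of_le₀ ?_ (Real.exp_pos _).le
      -- The centred test vector ranges over an interval of length 2, so the Hoeffding exponent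
      -- 4ε²/8 is the compensator ε²/2.
      refine (sum_mul_exp_le hpy (a := -1 - M) (b := 1 - M) (z := fun x => s x - M)
        (fun x => ⟨?_, ?_⟩) ?_ ε).trans_eq ?_
      · linarith [(abs_le.1 (hs x)).1]
      · linarith [(abs_le.1 (hs x)).2]
      · simp_rw [mul_sub]
        rw [Finset.sum_sub_distrib, ← Finset.sum_mul, hpy.2, one_mul]
        exact sub_self _
      · congr 1
        ring
    · simp only [h, if_false, mul_one]
      exact (sum_stepMatrix hp (hrun.policy t ht ω) hnI u).le

variable [IsProbabilityMeasure P]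

/-- The tilt is taken equal to the threshold per visit: a deviation of mε makes the exponent at
least ε·mε - mε²/2 = mε²/2. -/
theorem measure_deviation_le (hp : IsKernel N p) (hρ : ρ ∈ stdSimplex ℝ (X × A))
    (hrun : IsRun P 𝓕 N T p ρ α δ ℓ η D f g Y π) (hn : n < N) {s : X → ℝ}
    (hs : ∀ x, |s x| ≤ 1) {ε : ℝ} (hε : 0 ≤ ε) (m : ℕ) (y : X × A) :
    P {ω | ∃ t ≤ T, visits (fun i => Y i ω) t n y = m ∧
        m * ε ≤ deviation p s (fun i => Y i ω) t n y} ≤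
      ENNReal.ofReal (Real.exp (-(m * ε ^ 2 / 2))) := by
  refine (measure_mono ?_).trans
    ((isFactor_visitFactor hp hρ hrun hn hs hε m y).measure_le hp hrun hn (m * ε ^ 2 / 2))
  rintro ω ⟨t, ht, rfl, hdev⟩
  rw [Set.mem_ofPred_eq, prod_visitFactor_eq p s ε n y _ ht, Real.exp_le_exp]
  have := mul_le_mul_of_nonneg_left hdev hε
  linarith

/-- If the model is inaccurate, some deviation against a vector of signs is large. -/
theorem exists_deviation_of_not_modelAccurate (hp : IsKernel N p)
    (hC : 1 ≤ bonusConst X A N T δ) {Z : ℕ → ℕ → X × A} (hM : ¬ ModelAccurate N T p δ Z) :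
    ∃ (n : Fin N) (y : X × A) (σ : X → Bool) (i : Fin T), ∃ t ≤ T,
      visits Z t n y = (i : ℕ) + 1 ∧
      ((i : ℕ) + 1 : ℕ) * (bonusConst X A N T δ / √(((i : ℕ) + 1 : ℕ) : ℝ)) ≤
        deviation p (fun x => if σ x then 1 else -1) Z t n y := by
  unfold ModelAccurate at hM
  push Not at hM
  obtain ⟨t, ht, ht0, n, hn, y, hlt⟩ := hM
  have hpy := hp (n + 1) (Finset.mem_Icc.2 ⟨by omega, hn⟩) y.1 y.2
  have hest : ∀ x, estKernel Z t (n + 1) y.1 y.2 x =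
      transitions Z t n y x / max 1 (visits Z t n y : ℝ) := fun x => by
    simp [estKernel, ht0]
  simp_rw [hest] at hlt
  unfold bonus at hlt
  have hvt := visits_le Z t n y
  rcases Nat.eq_zero_or_pos (visits Z t n y) with h0 | hpos
  -- The estimated row is zero here, so the error is exactly 1, which is not above the bonus C ≥ 1.
  · exfalso
    have htr : ∀ x, transitions Z t n y x = 0 := fun x =>
      (Finset.sum_eq_zero_iff.1 ((sum_transitions Z t n y).trans h0)) x (Finset.mem_univ x)
    simp only [h0, htr, Nat.cast_zero, zero_div, sub_zero] at hlt
    rw [Finset.sum_congr rfl fun x _ => abs_of_nonneg (hpy.1 x), hpy.2] at hlt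
    simp only [zero_le_one, sup_of_le_left, Real.sqrt_one, div_one] at hlt
    linarith
  · have hpos' : (1 : ℝ) ≤ visits Z t n y := by exact_mod_cast hpos
    rw [max_eq_right hpos'] at hlt
    -- The signs of the coordinate errors turn the L¹ norm into a linear functional. The visit count
    -- lies between 1 and `T`, hence the shift by one to index it by `Fin T`.
    refine ⟨⟨n, hn⟩, y, fun x => decide (0 ≤ (transitions Z t n y x : ℝ) / visits Z t n y -
      p (n + 1) y.1 y.2 x), ⟨visits Z t n y - 1, by omega⟩, t, ht.le, ?_, ?_⟩
    · simp only
      omega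
    · have hm : visits Z t n y - 1 + 1 = visits Z t n y := by omega
      simp only [hm]
      refine (mul_le_mul_of_nonneg_left hlt.le (by positivity)).trans_eq ?_
      unfold deviation
      rw [Finset.mul_sum]
      refine Finset.sum_congr rfl fun x _ => ?_
      have hfac : (transitions Z t n y x : ℝ) - visits Z t n y * p (n + 1) y.1 y.2 x =
          visits Z t n y * ((transitions Z t n y x : ℝ) / visits Z t n y -
            p (n + 1) y.1 y.2 x) := by
        field_simp
      rw [hfac, abs_sub_comm]
      by_cases h : 0 ≤ (transitions Z t n y x : ℝ) / visits Z t n y - p (n + 1) y.1 y.2 x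
      · simp only [h, decide_true, if_true]
        rw [abs_of_nonneg h, one_mul]
      · simp only [h, decide_false, Bool.false_eq_true, if_false]
        rw [abs_of_neg (not_le.1 h)]
        ring

/-- Union bound over step, pair, sign vector and visit count m. With ε = C/√m the exponent mε²/2 is
C²/2 for every m. -/
theorem measure_not_modelAccurate_le (hp : IsKernel N p) (hρ : ρ ∈ stdSimplex ℝ (X × A))
    (hrun : IsRun P 𝓕 N T p ρ α δ ℓ η D f g Y π) (hC : 1 ≤ bonusConst X A N T δ) :
    P {ω | ¬ ModelAccurate N T p δ fun s => Y s ω} ≤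
      ENNReal.ofReal (N * (Fintype.card X * Fintype.card A) * 2 ^ Fintype.card X * T *
        Real.exp (-(bonusConst X A N T δ ^ 2 / 2))) := by
  set C := bonusConst X A N T δ with hCdef
  set S : Fin N × (X × A) × (X → Bool) × Fin T → Set Ω := fun i =>
    {ω | ∃ t ≤ T, visits (fun s => Y s ω) t i.1 i.2.1 = (i.2.2.2 : ℕ) + 1 ∧
      ((i.2.2.2 : ℕ) + 1 : ℕ) * (C / √(((i.2.2.2 : ℕ) + 1 : ℕ) : ℝ)) ≤
        deviation p (fun x => if i.2.2.1 x then 1 else -1) (fun s => Y s ω) t i.1 i.2.1} with hS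
  have hsub : {ω | ¬ ModelAccurate N T p δ fun s => Y s ω} ⊆ ⋃ i, S i := fun ω hω => by
    obtain ⟨n, y, σ, i, h⟩ := exists_deviation_of_not_modelAccurate hp hC hω
    exact Set.mem_iUnion.2 ⟨(n, y, σ, i), h⟩
  have hSi : ∀ i, P (S i) ≤ ENNReal.ofReal (Real.exp (-(C ^ 2 / 2))) := fun i => by
    have h := measure_deviation_le hp hρ hrun i.1.2
      (s := fun x => if i.2.2.1 x then 1 else -1) (fun x => by split_ifs <;> simp)
      (ε := C / √(((i.2.2.2 : ℕ) + 1 : ℕ) : ℝ)) (by positivity) ((i.2.2.2 : ℕ) + 1) i.2.1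
    refine h.trans_eq ?_
    rw [div_pow, Real.sq_sqrt (Nat.cast_nonneg _), mul_div_cancel₀]
    positivity
  refine (measure_mono hsub).trans ((measure_iUnion_fintype_le P S).trans ?_)
  refine (Finset.sum_le_card_nsmul _ _ _ fun i _ => hSi i).trans_eq ?_
  rw [nsmul_eq_mul, ← ENNReal.ofReal_natCast, ← ENNReal.ofReal_mul (Nat.cast_nonneg _)]
  congr 1
  simp
  ring

theorem measure_exists_sum_bonus_le (hp : IsKernel N p) (hρ : ρ ∈ stdSimplex ℝ (X × A))
    (hrun : IsRun P 𝓕 N T p ρ α δ ℓ η D f g Y π) (hT : 1 ≤ T)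
    (hC : 1 ≤ bonusConst X A N T δ) {L : ℝ} (hL : 0 ≤ L) :
    P {ω | ∃ n < N, bonusConst X A N T δ * √(2 * T * L) < ∑ t ∈ Finset.range T,
        (∑ y, occ p (π t ω) (startDist N p ρ (fun s => π s ω) t) n y *
            bonus N T δ (fun s => Y s ω) t n y - bonus N T δ (fun s => Y s ω) t n (Y t ω n))} ≤
      ENNReal.ofReal (N * Real.exp (-L)) := by
  set C := bonusConst X A N T δ with hCdef
  set S : Fin N → Set Ω := fun n => {ω | C * √(2 * T * L) < ∑ t ∈ Finset.range T,
    (∑ y, occ p (π t ω) (startDist N p ρ (fun s => π s ω) t) n y *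
      bonus N T δ (fun s => Y s ω) t n y - bonus N T δ (fun s => Y s ω) t n (Y t ω n))} with hS
  have hT' : (0 : ℝ) < T := by exact_mod_cast hT
  have hSn : ∀ n, P (S n) ≤ ENNReal.ofReal (Real.exp (-L)) := fun n => by
    -- With this tilt the exponent is 2L - L/4, more than the required L.
    refine (measure_sum_bonus_le hp hρ hrun n.2 (c := √(2 * T * L) / (T * C)) (by positivity)
      (C * √(2 * T * L))).trans (ENNReal.ofReal_le_ofReal (Real.exp_le_exp.2 (neg_le_neg ?_)))
    have hsq : √(2 * T * L) ^ 2 = 2 * T * L := Real.sq_sqrt (by positivity)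
    have h1 : √(2 * T * L) / (T * C) * (C * √(2 * T * L)) = 2 * L := by
      have : √(2 * T * L) / (T * C) * (C * √(2 * T * L)) = √(2 * T * L) ^ 2 / T := by field_simp
      rw [this, hsq]
      field_simp
    have h2 : T * ((√(2 * T * L) / (T * C)) ^ 2 * C ^ 2 / 8) = L / 4 := by
      rw [div_pow, hsq]
      field_simp
      ring
    rw [h1, h2]
    linarith
  have hsub : {ω | ∃ n < N, C * √(2 * T * L) < ∑ t ∈ Finset.range T,
      (∑ y, occ p (π t ω) (startDist N p ρ (fun s => π s ω) t) n y *
        bonus N T δ (fun s => Y s ω) t n y - bonus N T δ (fun s => Y s ω) t n (Y t ω n))} ⊆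
      ⋃ n, S n := by
    rintro ω ⟨n, hn, h⟩
    exact Set.mem_iUnion.2 ⟨⟨n, hn⟩, h⟩
  refine (measure_mono hsub).trans ((measure_iUnion_fintype_le P S).trans ?_)
  refine (Finset.sum_le_card_nsmul _ _ _ fun i _ => hSn i).trans_eq ?_
  rw [nsmul_eq_mul, ← ENNReal.ofReal_natCast, ← ENNReal.ofReal_mul (Nat.cast_nonneg _)]
  simp

end Run

/-! ### Constants and total failure probability. -/

section Final

variable {X : Type u} {A : Type v} [Fintype X] [Fintype A] [DecidableEq X] [DecidableEq A]
  {N T : ℕ} {p : ℕ → X → A → X → ℝ} {ρ : X × A → ℝ} {α δ ℓ : ℝ}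

theorem sum_expBonus_le {Y : ℕ → ℕ → X × A} {π : ℕ → ℕ → X → A → ℝ} {r : ℝ}
    (hr : ∀ n < N, ∑ t ∈ Finset.range T,
      (∑ y, occ p (π t) (startDist N p ρ π t) n y * bonus N T δ Y t n y -
        bonus N T δ Y t n (Y t n)) ≤ r) :
    ∑ t ∈ Finset.range T, expBonus N T p ρ δ Y π t ≤
      N * (bonusConst X A N T δ * (3 * √((Fintype.card X : ℝ) * Fintype.card A * T)) + r) := by
  unfold expBonus
  rw [Finset.sum_comm]
  refine (Finset.sum_le_card_nsmul _ _ _ fun n hn => ?_).trans_eq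
    (by rw [Finset.card_range, nsmul_eq_mul])
  have h := hr n (Finset.mem_range.1 hn)
  rw [Finset.sum_sub_distrib] at h
  have hb : ∑ t ∈ Finset.range T, bonus N T δ Y t n (Y t n) ≤
      bonusConst X A N T δ * (3 * √((Fintype.card X : ℝ) * Fintype.card A * T)) := by
    refine le_trans (le_of_eq ?_) (mul_le_mul_of_nonneg_left
      (sum_one_div_sqrt_visits_le_sqrt Y T n) (bonusConst_nonneg N T δ))
    rw [Finset.mul_sum]
    exact Finset.sum_congr rfl fun t _ => (mul_one_div _ _).symm
  linarith

/-- The arithmetic of the constants: `x = |X|`, `a = |A|`, `L` is the logarithm. -/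
theorem regret_const_le {x a T N L ℓ c C E R : ℝ} (hx : 1 ≤ x) (ha : 1 ≤ a) (hT : 0 ≤ T)
    (hN : 1 ≤ N) (hL : 1 ≤ L) (hℓ : 0 ≤ ℓ) (hc : 0 ≤ c) (hCdef : C = √(2 * x * L)) (hC : 1 ≤ C)
    (hE : E ≤ N * (C * (3 * √(x * a * T)) + C * √(2 * T * L)))
    (hR : R ≤ c * (2 * ((1 + N * C) * E))) :
    N * (ℓ * (1 + N * C)) * R ≤ 160 * c * ℓ * N ^ 4 * x ^ 2 * √(a * T) * L ^ 3 := by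
  set Q := √(x * a * T) with hQ
  have hQ0 : 0 ≤ Q := Real.sqrt_nonneg _
  -- This makes the Azuma term at most 2LCQ, so that it merges with 3CQ into 5LCQ.
  have hxL : 2 * T * L ≤ (2 * L) ^ 2 * (x * a * T) := by
    have h1 : 1 ≤ x * a := one_le_mul_of_one_le_of_one_le hx ha
    have h2 : T ≤ x * a * T := le_mul_of_one_le_left hT h1
    have h3 : 2 * L ≤ (2 * L) ^ 2 := by nlinarith
    calc 2 * T * L = 2 * L * T := by ring
      _ ≤ (2 * L) ^ 2 * (x * a * T) := mul_le_mul h3 h2 hT (by positivity)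
  have hdev : √(2 * T * L) ≤ 2 * L * Q := by
    refine (Real.sqrt_le_sqrt hxL).trans_eq ?_
    rw [Real.sqrt_mul (by positivity), Real.sqrt_sq (by positivity)]
  have hE' : E ≤ N * (5 * L * C * Q) := by
    refine hE.trans (mul_le_mul_of_nonneg_left ?_ (by positivity))
    have h1 : C * √(2 * T * L) ≤ C * (2 * L * Q) := mul_le_mul_of_nonneg_left hdev (by positivity)
    have h2 : C * (3 * Q) ≤ L * (C * (3 * Q)) := le_mul_of_one_le_left (by positivity) hL
    linarith
  have hNC : 1 + N * C ≤ 2 * N * C := by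
    have := one_le_mul_of_one_le_of_one_le hN hC
    linarith
  have hNC0 : 0 ≤ 1 + N * C := by positivity
  have hR' : R ≤ c * (2 * (2 * N * C * (N * (5 * L * C * Q)))) := by
    refine hR.trans (mul_le_mul_of_nonneg_left (mul_le_mul_of_nonneg_left ?_ zero_le_two) hc)
    exact (mul_le_mul_of_nonneg_left hE' hNC0).trans
      (mul_le_mul_of_nonneg_right hNC (by positivity))
  have hmain : N * (ℓ * (1 + N * C)) * R ≤
      N * (ℓ * (2 * N * C)) * (c * (2 * (2 * N * C * (N * (5 * L * C * Q))))) := by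
    refine (mul_le_mul_of_nonneg_left hR' (by positivity)).trans ?_
    refine mul_le_mul_of_nonneg_right ?_ (by positivity)
    exact mul_le_mul_of_nonneg_left (mul_le_mul_of_nonneg_left hNC hℓ) (by positivity)
  have hC2 : C ^ 2 = 2 * x * L := by rw [hCdef, Real.sq_sqrt (by positivity)]
  -- Of the three factors C in the bound, one is paired with Q to make |X| come out of the root; the
  -- other two give 2xL. The constant is 40·2·2 = 160.
  have hCQ : C * Q ≤ 2 * L * x * √(a * T) := by
    have h1 : C * Q = √(2 * L * (x ^ 2 * (a * T))) := by
      rw [hCdef, hQ, ← Real.sqrt_mul (by positivity)]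
      congr 1
      ring
    have h2 : 2 * L * x * √(a * T) = √((2 * L) ^ 2 * (x ^ 2 * (a * T))) := by
      rw [Real.sqrt_mul (sq_nonneg (2 * L)), Real.sqrt_mul (sq_nonneg x),
        Real.sqrt_sq (by positivity), Real.sqrt_sq (by positivity), mul_assoc]
    rw [h1, h2]
    refine Real.sqrt_le_sqrt (mul_le_mul_of_nonneg_right ?_ (by positivity))
    nlinarith
  refine hmain.trans ?_
  calc N * (ℓ * (2 * N * C)) * (c * (2 * (2 * N * C * (N * (5 * L * C * Q)))))
      = 40 * c * ℓ * N ^ 4 * L * C ^ 2 * (C * Q) := by ring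
    _ ≤ 40 * c * ℓ * N ^ 4 * L * C ^ 2 * (2 * L * x * √(a * T)) :=
        mul_le_mul_of_nonneg_left hCQ (by positivity)
    _ = 160 * c * ℓ * N ^ 4 * x ^ 2 * √(a * T) * L ^ 3 := by
        rw [hC2]
        ring

/-- With one episode, or a single state-action pair, all initial distributions are `ρ`. -/
theorem startDist_eq_of_trivial {π : ℕ → ℕ → X → A → ℝ} (hp : IsKernel N p)
    (hρ : ρ ∈ stdSimplex ℝ (X × A)) (hπ : ∀ t < T, IsPolicy N (π t))
    (h : Fintype.card X * Fintype.card A * T < 2 * T ∨ T ≤ 1) :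
    ∀ t < T, startDist N p ρ π t = ρ := by
  intro t ht
  rcases h with h | h
  · have hcard : Fintype.card (X × A) ≤ 1 := by
      rw [Fintype.card_prod]
      exact Nat.lt_succ_iff.1 (lt_of_mul_lt_mul_right h (Nat.zero_le _))
    have := Fintype.card_le_one_iff_subsingleton.1 hcard
    have hs := startDist_mem_stdSimplex hp hρ hπ t ht.le
    funext y
    rw [← Fintype.sum_subsingleton (startDist N p ρ π t) y, ← Fintype.sum_subsingleton ρ y, hs.2,
      hρ.2]
  · obtain rfl : t = 0 := by omega
    rfl

variable {Ω : Type w} [mΩ : MeasurableSpace Ω] {P : Measure Ω} {𝓕 : Filtration ℕ mΩ} {η : ℝ}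
  {D : (Fin (N + 1) → X × A → ℝ) → (Fin (N + 1) → X × A → ℝ) → ℝ}
  {f : ℕ → Ω → ℕ → (X × A → ℝ) → ℝ} {g : ℕ → Ω → ℕ → X × A → ℝ}
  {Y : ℕ → Ω → ℕ → X × A} {π : ℕ → Ω → ℕ → X → A → ℝ}

theorem IsRun.abs_subgradient_le (hrun : IsRun P 𝓕 N T p ρ α δ ℓ η D f g Y π) {t : ℕ}
    (ht : t < T) (ω : Ω) {n : ℕ} (hn : n ∈ Finset.Icc 1 N) (y : X × A) : |g t ω n y| ≤ ℓ :=
  abs_le_of_isSubgradient (hrun.loss_convex t ht ω n hn).2 (hrun.subgradient t ht ω n hn) y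

/-- A periodic policy shows that the feasible set is nonempty, so the constraint binds the played
policy. -/
theorem IsRun.occ_mem_feasibleSet [Nonempty X] (hrun : IsRun P 𝓕 N T p ρ α δ ℓ η D f g Y π)
    (hp : IsKernel N p) (hρ : ρ ∈ stdSimplex ℝ (X × A)) (hper : ∃ π, IsPeriodic N p ρ π)
    (hcontr : PeriodicContraction N p ρ α) {ω : Ω}
    (hM : ModelAccurate N T p δ fun s => Y s ω) {t : ℕ} (ht : t < T) (ht0 : t ≠ 0) :
    occ (estKernel (fun s => Y s ω) t) (π t ω) (startDist N p ρ (fun s => π s ω) t) ∈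
      feasibleSet N (estKernel (fun s => Y s ω) t) (startDist N p ρ (fun s => π s ω) t) ρ
        (bonus N T δ (fun s => Y s ω) t) α := by
  obtain ⟨πc, hπc⟩ := hper
  obtain ⟨t, rfl⟩ := Nat.exists_eq_succ_of_ne_zero ht0
  exact (hrun.mirror_step t ht ω ⟨_, PeriodicMDP.occ_mem_feasibleSet hp hρ
    (fun s hs => hrun.policy s hs ω) hcontr hπc hM ht ht0⟩).1

/-- The regret bound for one outcome, when the model is accurate and the bonuses concentrate. -/
theorem IsRun.diffRegret_le [Nonempty X] [Nonempty A]
    (hrun : IsRun P 𝓕 N T p ρ α δ ℓ η D f g Y π) (hN : 1 ≤ N) (hT : 1 ≤ T)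
    (hp : IsKernel N p) (hρ : ρ ∈ stdSimplex ℝ (X × A)) (hα0 : 0 ≤ α) (hα1 : α < 1)
    (hper : ∃ π, IsPeriodic N p ρ π) (hcontr : PeriodicContraction N p ρ α) {L : ℝ} (hL : 1 ≤ L)
    (hCL : bonusConst X A N T δ = √(2 * Fintype.card X * L)) (hC : 1 ≤ bonusConst X A N T δ)
    {ω : Ω} (hM : ModelAccurate N T p δ fun s => Y s ω)
    (hr : ∀ n < N, ∑ t ∈ Finset.range T,
      (∑ y, occ p (π t ω) (startDist N p ρ (fun s => π s ω) t) n y *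
        bonus N T δ (fun s => Y s ω) t n y - bonus N T δ (fun s => Y s ω) t n (Y t ω n)) ≤
          bonusConst X A N T δ * √(2 * T * L)) {πc : ℕ → X → A → ℝ} (hπc : IsPolicy N πc) :
    diffRegret N T p ρ δ ℓ (fun t => g t ω) (fun t => Y t ω) (fun t => π t ω) πc ≤
      160 * (1 - α)⁻¹ * ℓ * (N : ℝ) ^ 4 * (Fintype.card X : ℝ) ^ 2 *
        √((Fintype.card A : ℝ) * T) * L ^ 3 := by
  have hπ : ∀ t < T, IsPolicy N (π t ω) := fun t ht => hrun.policy t ht ω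
  have hg : ∀ t < T, ∀ n ∈ Finset.Icc 1 N, ∀ y, |g t ω n y| ≤ ℓ := fun t ht n hn y =>
    hrun.abs_subgradient_le ht ω hn y
  have hℓ : 0 ≤ ℓ := (abs_nonneg _).trans
    (hg 0 hT 1 (Finset.mem_Icc.2 ⟨le_rfl, hN⟩) (Classical.arbitrary _))
  refine (diffRegret_le_sum_l1 (N := N) hℓ hg hπc).trans ?_
  exact regret_const_le (by exact_mod_cast Fintype.card_pos (α := X))
    (by exact_mod_cast Fintype.card_pos (α := A)) (Nat.cast_nonneg T) (by exact_mod_cast hN) hL hℓ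
    (inv_nonneg.2 (by linarith)) hCL hC (sum_expBonus_le hr)
    (sum_l1_startDist_le hN hp hρ hπ hα0 hα1 hC hM
      fun t ht ht0 => hrun.occ_mem_feasibleSet hp hρ hper hcontr hM ht ht0)

variable [IsProbabilityMeasure P]

/-- The probability that the model is inaccurate or that the bonuses fail to concentrate. -/
theorem IsRun.measure_bad_le (hrun : IsRun P 𝓕 N T p ρ α δ ℓ η D f g Y π) (hX : 1 ≤ Fintype.card X)
    (hA : 1 ≤ Fintype.card A) (hT : 1 ≤ T) (hN : 1 ≤ N)
    (hp : IsKernel N p) (hρ : ρ ∈ stdSimplex ℝ (X × A)) (hδ : 0 < δ)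
    (hC : 1 ≤ bonusConst X A N T δ)
    (hK : 2 * δ ≤ (Fintype.card X : ℝ) * Fintype.card A * N * T) {L : ℝ} (hL0 : 0 ≤ L)
    (hL : L = Real.log ((Fintype.card X : ℝ) * Fintype.card A * N * T / δ)) :
    P ({ω | ¬ ModelAccurate N T p δ fun s => Y s ω} ∪
      {ω | ∃ n < N, bonusConst X A N T δ * √(2 * T * L) < ∑ t ∈ Finset.range T,
        (∑ y, occ p (π t ω) (startDist N p ρ (fun s => π s ω) t) n y *
          bonus N T δ (fun s => Y s ω) t n y - bonus N T δ (fun s => Y s ω) t n (Y t ω n))}) ≤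
      ENNReal.ofReal (3 * δ) := by
  have hX' : (1 : ℝ) ≤ Fintype.card X := by exact_mod_cast hX
  have hA' : (1 : ℝ) ≤ Fintype.card A := by exact_mod_cast hA
  have hN' : (1 : ℝ) ≤ N := by exact_mod_cast hN
  have hT' : (1 : ℝ) ≤ T := by exact_mod_cast hT
  set K : ℝ := (Fintype.card X : ℝ) * Fintype.card A * N * T with hKdef
  have hK0 : 0 < K := by positivity
  have hexp : Real.exp (-L) = δ / K := by
    rw [Real.exp_neg, hL, Real.exp_log (by positivity), inv_div]
  have hC2 : bonusConst X A N T δ ^ 2 / 2 = Fintype.card X * L := by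
    rw [bonusConst, ← hKdef, ← hL, Real.sq_sqrt (by positivity)]
    ring
  -- The factor |X| in C² yields (δ/K)^|X|, which absorbs the 2^|X| sign vectors because 2δ ≤ K.
  have h1 : N * ((Fintype.card X : ℝ) * Fintype.card A) * 2 ^ Fintype.card X * T *
      Real.exp (-(bonusConst X A N T δ ^ 2 / 2)) ≤ 2 * δ := by
    rw [hC2, ← mul_neg, Real.exp_nat_mul, hexp]
    calc N * ((Fintype.card X : ℝ) * Fintype.card A) * 2 ^ Fintype.card X * T *
          (δ / K) ^ Fintype.card X
        = K * (2 * δ / K) ^ Fintype.card X := by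
          rw [mul_div_assoc, mul_pow, hKdef]
          ring
      _ ≤ K * (2 * δ / K) := by
          refine mul_le_mul_of_nonneg_left ?_ hK0.le
          exact pow_le_of_le_one (by positivity) ((div_le_one hK0).2 hK) (by omega)
      _ = 2 * δ := mul_div_cancel₀ _ hK0.ne'
  have h2 : N * Real.exp (-L) ≤ δ := by
    rw [hexp, ← mul_div_assoc, div_le_iff₀ hK0, mul_comm]
    refine mul_le_mul_of_nonneg_left ?_ hδ.le
    have h3 : 1 ≤ (Fintype.card X : ℝ) * Fintype.card A :=
      one_le_mul_of_one_le_of_one_le hX' hA'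
    calc (N : ℝ) ≤ (Fintype.card X : ℝ) * Fintype.card A * N :=
          le_mul_of_one_le_left (by positivity) h3
      _ ≤ K := le_mul_of_one_le_right (by positivity) hT'
  refine (measure_union_le _ _).trans ?_
  refine (add_le_add (measure_not_modelAccurate_le hp hρ hrun hC)
    (measure_exists_sum_bonus_le hp hρ hrun hT hC hL0)).trans ?_
  rw [← ENNReal.ofReal_add (by positivity) (by positivity)]
  exact ENNReal.ofReal_le_ofReal (by linarith)

end Final

end PeriodicMDP

theorem mainTheorem6 :
    ∃ (C : ℝ) (k : ℕ), 0 < C ∧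
      ∀ (X : Type u) (A : Type v) [Fintype X] [Fintype A] [DecidableEq X] [DecidableEq A]
        (N T : ℕ) (_ : 1 ≤ N) (_ : 1 ≤ T)
        (p : ℕ → X → A → X → ℝ) (_ : PeriodicMDP.IsKernel N p)
        (ρ : X × A → ℝ) (_ : ρ ∈ stdSimplex ℝ (X × A))
        (α : ℝ) (_ : 0 ≤ α) (_ : α < 1)
        (_ : ∃ π, PeriodicMDP.IsPeriodic N p ρ π)
        (_ : PeriodicMDP.PeriodicContraction N p ρ α)
        (δ : ℝ) (_ : 0 < δ) (_ : δ < 1) (ℓ η : ℝ) (_ : 0 < η)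
        (ψ : (Fin (N + 1) → X × A → ℝ) → ℝ)
        (D : (Fin (N + 1) → X × A → ℝ) → (Fin (N + 1) → X × A → ℝ) → ℝ)
        (_ : PeriodicMDP.IsBregmanDivergence N ψ D)
        (Ω : Type w) [mΩ : MeasurableSpace Ω] (P : Measure Ω) [IsProbabilityMeasure P]
        (𝓕 : Filtration ℕ mΩ)
        (f : ℕ → Ω → ℕ → (X × A → ℝ) → ℝ) (g : ℕ → Ω → ℕ → X × A → ℝ)
        (Y : ℕ → Ω → ℕ → X × A) (π : ℕ → Ω → ℕ → X → A → ℝ)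
        (_ : PeriodicMDP.IsRun P 𝓕 N T p ρ α δ ℓ η D f g Y π),
        P {ω | ∃ πc, PeriodicMDP.IsPeriodic N p ρ πc ∧
            C * (1 - α)⁻¹ * ℓ * (N : ℝ) ^ 4 * (Fintype.card X : ℝ) ^ 2
                * √((Fintype.card A : ℝ) * T)
                * Real.log ((Fintype.card X : ℝ) * Fintype.card A * N * T / δ) ^ k
              < PeriodicMDP.diffRegret N T p ρ δ ℓ (fun t => g t ω) (fun t => Y t ω)
                  (fun t => π t ω) πc}
          ≤ ENNReal.ofReal (3 * δ) := by
  refine ⟨160, 3, by norm_num, ?_⟩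
  intro X A _ _ _ _ N T hN hT p hp ρ hρ α hα0 hα1 hper hcontr δ hδ0 hδ1 ℓ η _ ψ D _ Ω mΩ P _ 𝓕 f g
    Y π hrun
  have hne : Nonempty (X × A) := by
    by_contra h
    rw [not_nonempty_iff] at h
    simpa using hρ.2
  have : Nonempty X := hne.map Prod.fst
  have : Nonempty A := hne.map Prod.snd
  have hX : 1 ≤ Fintype.card X := Fintype.card_pos
  have hA : 1 ≤ Fintype.card A := Fintype.card_pos
  have hX' : (1 : ℝ) ≤ Fintype.card X := by exact_mod_cast hX
  -- In the degenerate cases the logarithm may be close to 0, but the left side vanishes. Otherwise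
  -- |X||A|NT ≥ 4 > e, so L ≥ 1 and C ≥ 1.
  by_cases htriv : Fintype.card X * Fintype.card A * T < 2 * T ∨ T ≤ 1
  · refine le_of_eq_of_le (measure_mono_null (t := ∅) ?_ measure_empty) zero_le
    rintro ω ⟨πc, -, hlt⟩
    rw [PeriodicMDP.diffRegret_eq_zero (PeriodicMDP.startDist_eq_of_trivial hp hρ
      (fun t ht => hrun.policy t ht ω) htriv)] at hlt
    refine absurd hlt (not_lt.2 ?_)
    have hℓ : 0 ≤ ℓ := (abs_nonneg _).trans (hrun.abs_subgradient_le hT ω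
      (Finset.mem_Icc.2 ⟨le_rfl, hN⟩) hne.some)
    have hα : 0 ≤ (1 - α)⁻¹ := inv_nonneg.2 (by linarith)
    have hK : 1 ≤ Fintype.card X * Fintype.card A * N * T :=
      Nat.mul_pos (Nat.mul_pos (Nat.mul_pos hX hA) hN) hT
    have hK' : (1 : ℝ) ≤ (Fintype.card X : ℝ) * Fintype.card A * N * T := by exact_mod_cast hK
    have hlog := Real.log_nonneg ((one_le_div hδ0).2 (hδ1.le.trans hK'))
    positivity
  · push Not at htriv
    obtain ⟨h1, h2⟩ := htriv
    have hK : 4 ≤ Fintype.card X * Fintype.card A * N * T := by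
      calc 4 ≤ 2 * T := by omega
        _ ≤ Fintype.card X * Fintype.card A * T := h1
        _ ≤ Fintype.card X * Fintype.card A * T * N := Nat.le_mul_of_pos_right _ hN
        _ = Fintype.card X * Fintype.card A * N * T := by ring
    have hK' : (4 : ℝ) ≤ (Fintype.card X : ℝ) * Fintype.card A * N * T := by exact_mod_cast hK
    set L := Real.log ((Fintype.card X : ℝ) * Fintype.card A * N * T / δ) with hLdef
    have hL : 1 ≤ L := by
      have h4 : (4 : ℝ) ≤ (Fintype.card X : ℝ) * Fintype.card A * N * T / δ := by
        rw [le_div_iff₀ hδ0]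
        linarith
      rw [hLdef, Real.le_log_iff_exp_le (by linarith)]
      linarith [Real.exp_one_lt_d9]
    have hCL : PeriodicMDP.bonusConst X A N T δ = √(2 * Fintype.card X * L) := rfl
    have hC : 1 ≤ PeriodicMDP.bonusConst X A N T δ := by
      rw [hCL, Real.one_le_sqrt]
      nlinarith
    -- Monotonicity of the outer measure needs no measurability of the failure set, which is a union
    -- over all periodic comparators.
    refine (measure_mono ?_).trans (hrun.measure_bad_le hX hA hT hN hp hρ hδ0 hC
      (by linarith) (by linarith) hLdef)
    rintro ω ⟨πc, hπc, hlt⟩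
    by_contra hgood
    rw [Set.mem_union, not_or] at hgood
    obtain ⟨hM, hr⟩ := hgood
    simp only [Set.mem_ofPred_eq, not_not] at hM
    simp only [Set.mem_ofPred_eq, not_exists, not_and, not_lt] at hr
    exact absurd hlt (not_lt.2 (hrun.diffRegret_le hN hT hp hρ hα0 hα1 hper hcontr hL hCL hC hM hr
      hπc.1))
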